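/- Conventions. A network consists of a finite directed acyclic multigraph with a source node, a set of terminal nodes, and a number $h$ of source messages $x_1,\dots,x_h$. For a prime power $q$ and an integer $t\ge 1$, a $(q,t)$-linear solution takes $x_1,\dots,x_h\in\mathbb F_q^t$ and lets every edge $e$ carry a vector of $\mathbb F_q^t$: an edge leaving the source carries a linear combination, with $t\times t$ coefficient matrices over $\mathbb F_q$, of the messages; an edge leaving any other node carries such a linear combination of the vectors carried by the edges entering that node. Thus $e$ carries $G_e\cdot(x_1|\cdots|x_h)^T$ for a $t\times ht$ matrix $G_e$, and it is required that at every terminal the matrix obtained by stacking the $G_e$ of its incoming edges has rank $ht$ (so that the terminal recovers all messages). Let $q_s(\mathcal N)$ be the smallest prime power $q$ for which $\mathcal N$ has a $(q,1)$-linear solution, let $q_v(\mathcal N)$ be the smallest value $q^t$ ($q$ a prime power, $t\ge 1$) for which $\mathcal N$ has a $(q,t)$-linear solution, and let $\mathrm{gap}(\mathcal N)=q_s(\mathcal N)-q_v(\mathcal N)$. For real $x>0$ let $\psi(x)$ be the smallest prime power that is at least $x$. For a prime power $q$ and integers $t\ge1$, $h\ge 2$, the Kneser network $\mathcal K_{q,t;h}$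 has $h$ messages, a source, a middle layer with one node for each $t$-dimensional subspace of $V=\mathbb F_q^{ht}$, and one terminal for each set of $h$ distinct $t$-dimensional subspaces of $V$ whose sum is $V$. There is one edge from the source to each middle node, and one edge to each terminal from each of the $h$ middle nodes of its set. Theorem. For every prime power $q$ and every integer $t\ge 2$, $$\mathrm{gap}(\mathcal K_{q,t;2})\ \ge\ \psi(q^t+1)-q^t\ \ge\ 1 .$$ -/

import Mathlib

universe u

/-- A (multicast) network: a finite directed acyclic multigraph with a designated source node,
a set of terminal nodes, and a number `h` of source messages. -/
structure MulticastNetwork where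
  /-- the nodes -/
  V : Type u
  /-- the edges (parallel edges are allowed) -/
  E : Type u
  [fintypeV : Fintype V]
  [fintypeE : Fintype E]
  [decEqV : DecidableEq V]
  /-- the node an edge leaves -/
  tail : E → V
  /-- the node an edge enters -/
  head : E → V
  acyclic : ∀ v : V,
    ¬ Relation.TransGen (fun a b : V => ∃ e : E, tail e = a ∧ head e = b) v v
  source : V
  terminals : Set V
  h : ℕ

namespace MulticastNetwork

attribute [instance] MulticastNetwork.fintypeV MulticastNetwork.fintypeE
  MulticastNetwork.decEqV

/-- The set of incoming edges of a node, as a type. -/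
abbrev In (N : MulticastNetwork.{u}) (v : N.V) : Type u := {e : N.E // N.head e = v}

/-- The matrix `G_v` of a node: the global coding matrices of the incoming edges of `v`,
stacked on top of each other. -/
def nodeMatrix (N : MulticastNetwork.{u}) {F : Type*} {t : ℕ}
    (G : N.E → Matrix (Fin t) (Fin (N.h * t)) F) (v : N.V) :
    Matrix (N.In v × Fin t) (Fin (N.h * t)) F :=
  Matrix.of fun i j => G i.1.1 i.2 j

/-- A linear solution over `F` with vectors of length `t`. The edge `e` carries
`globalMatrix e * x`, where `x` is the column of length `h * t` formed by the `h` source messages.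
An edge leaving the source carries an arbitrary linear function of the messages; an edge leaving
any other node carries a linear combination of the incoming values of that node, with `t × t`
coefficient matrices. Every terminal recovers all the messages. -/
structure LinearSolution (N : MulticastNetwork.{u}) (F : Type*) [Field F] (t : ℕ) where
  globalMatrix : N.E → Matrix (Fin t) (Fin (N.h * t)) F
  localMatrix : N.E → N.E → Matrix (Fin t) (Fin t) F
  flow : ∀ e : N.E, N.tail e ≠ N.source →
    globalMatrix e = ∑ e' : N.In (N.tail e), localMatrix e e'.1 * globalMatrix e'.1
  decode : ∀ τ ∈ N.terminals, (N.nodeMatrix globalMatrix τ).rank = N.h * t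

/-- The network has a `(q, t)`-linear solution: a linear solution with vectors of length `t`
over a finite field with `q` elements. -/
def HasLinearSolution (N : MulticastNetwork.{u}) (q t : ℕ) : Prop :=
  ∃ (F : Type) (_ : Field F) (_ : Fintype F),
    Fintype.card F = q ∧ Nonempty (N.LinearSolution F t)

/-- The smallest field size of a scalar linear solution. -/
noncomputable def qs (N : MulticastNetwork.{u}) : ℕ :=
  sInf {q : ℕ | N.HasLinearSolution q 1}

/-- The smallest value `q ^ t`, `t ≥ 1`, such that there is a `(q, t)`-linear solution. -/
noncomputable def qv (N : MulticastNetwork.{u}) : ℕ :=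
  sInf {m : ℕ | ∃ q t : ℕ, 1 ≤ t ∧ N.HasLinearSolution q t ∧ m = q ^ t}

/-- The gap of a network. -/
noncomputable def gap (N : MulticastNetwork.{u}) : ℤ := (N.qs : ℤ) - (N.qv : ℤ)

end MulticastNetwork

/-- The smallest prime power that is at least `x`. -/
noncomputable def psi (x : ℝ) : ℕ := sInf {q : ℕ | IsPrimePow q ∧ x ≤ (q : ℝ)}

section Kneser

variable (F : Type u) [Field F] (t h : ℕ)

/-- The nodes of the middle layer: the `t`-dimensional subspaces of `F ^ (h * t)`. -/
abbrev KneserMiddle : Type u :=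
  {W : Submodule F (Fin (h * t) → F) // Module.finrank F W = t}

/-- The terminals: the sets of `h` distinct `t`-dimensional subspaces whose sum is the whole
space. -/
abbrev KneserTerminal : Type u :=
  {S : Finset (KneserMiddle F t h) // S.card = h ∧ (⨆ W ∈ S, W.1) = ⊤}

/-- The nodes: the source, the middle layer, the terminals. -/
abbrev KneserNode : Type u :=
  PUnit.{u + 1} ⊕ (KneserMiddle F t h ⊕ KneserTerminal F t h)

/-- The edges: one from the source to each middle node, and one to each terminal `S` from each
of the middle nodes that belong to `S`. -/
abbrev KneserEdge : Type u :=
  KneserMiddle F t h ⊕ (Σ S : KneserTerminal F t h, {W : KneserMiddle F t h // W ∈ S.1})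

variable {F t h}

/-- The node a given edge leaves. -/
def kneserTail : KneserEdge F t h → KneserNode F t h
  | Sum.inl _ => Sum.inl PUnit.unit
  | Sum.inr p => Sum.inr (Sum.inl p.2.1)

/-- The node a given edge enters. -/
def kneserHead : KneserEdge F t h → KneserNode F t h
  | Sum.inl W => Sum.inr (Sum.inl W)
  | Sum.inr p => Sum.inr (Sum.inr p.1)

/-- The layer of a node. -/
def kneserLayer : KneserNode F t h → ℕ
  | Sum.inl _ => 0
  | Sum.inr (Sum.inl _) => 1
  | Sum.inr (Sum.inr _) => 2

theorem kneser_acyclic (v : KneserNode F t h) :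
    ¬ Relation.TransGen
      (fun a b => ∃ e : KneserEdge F t h, kneserTail e = a ∧ kneserHead e = b) v v := by
  have key : ∀ a b : KneserNode F t h, Relation.TransGen
      (fun a b => ∃ e : KneserEdge F t h, kneserTail e = a ∧ kneserHead e = b) a b →
      kneserLayer a < kneserLayer b := by
    intro a b hab
    induction hab with
    | single hb =>
      obtain ⟨e, rfl, rfl⟩ := hb
      rcases e with W | p <;> simp [kneserTail, kneserHead, kneserLayer]
    | tail _ hb ih =>
      obtain ⟨e, rfl, rfl⟩ := hb
      refine ih.trans ?_
      rcases e with W | p <;> simp [kneserTail, kneserHead, kneserLayer]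
  exact fun hv => lt_irrefl _ (key v v hv)

variable (F t h)

/-- The Kneser network `K_{q,t;h}`, where `q` is the number of elements of the field `F`. -/
noncomputable def kneserNetwork [Finite F] : MulticastNetwork.{u} where
  V := KneserNode F t h
  E := KneserEdge F t h
  fintypeV := Fintype.ofFinite _
  fintypeE := Fintype.ofFinite _
  decEqV := Classical.decEq _
  tail := kneserTail
  head := kneserHead
  acyclic := kneser_acyclic
  source := Sum.inl PUnit.unit
  terminals := Set.range fun S : KneserTerminal F t h => Sum.inr (Sum.inr S)
  h := h

end Kneser

/-! Sending to each middle node the products of the message vector with a basis of its subspace is a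
vector solution over F_q, so q_v ≤ q^t. A scalar solution over a field with q' elements gives each
middle node a row of length two, and the two rows at a terminal are independent. It thus colours the
t-dimensional subspaces by the q' + 1 points of a projective line, complementary subspaces getting
distinct colours. The heart is `card_lt_of_colouring`: more than q^t + 1 colours are needed. Then q'
> q^t, and q' is a prime power.

Suppose q^t + 1 colours suffice. A spread has q^t + 1 pairwise complementary members, so it contains
each colour exactly once. Averaging over spreads through W₀ shows that the indicator f of a colour
has sum q^((t-1)t) (1 - f(W₀)) over the complements of W₀ (`sumCompl_classIndicator`). This
eigenvalue equation forces f to have degree one: f(W) is the sum over v in W of a signed weight g of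
total 1 (`eq_subspaceMass_of_sumCompl`).

Such 0-1 functions are rigid. If a (t-1)-dimensional S lies in more than one member of the colour
class, the members through S are all the t-dimensional subspaces above S or exactly those inside a
hyperplane (`star_eq_top_or_hyperplane`). Some S has two subspaces W₁, W₂ above it whose colours are
distinct and each used once there; T = W₁ ⊔ W₂ has mass 1 for both weights. Then both colours occur
above every (t-1)-dimensional H ≤ T, which forces H to have mass 0 for the first weight. Averaging
over the H inside W₁ gives W₁ mass 0, although its mass is f(W₁) = 1. -/

open scoped Classical
open Module Finset

set_option linter.unusedSectionVars false

/-! ### Masses of subspaces under a signed weight on vectors -/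

section SubspaceSums

variable {F V : Type*} [Field F] [Fintype F] [AddCommGroup V] [Module F V] [Fintype V]

theorem card_filter_mem_submodule (U : Submodule F V) :
    #{v : V | v ∈ U} = Fintype.card F ^ finrank F U := by
  rw [← Module.card_eq_pow_finrank (K := F) (V := U), Fintype.card_subtype]

/-- The total weight of the vectors of a subspace. -/
noncomputable def subspaceMass (g : V → ℝ) (U : Submodule F V) : ℝ := ∑ v with v ∈ U, g v

theorem subspaceMass_one (U : Submodule F V) :
    subspaceMass (fun _ => 1) U = (Fintype.card F : ℝ) ^ finrank F U := by
  rw [subspaceMass, sum_const, card_filter_mem_submodule]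
  simp

theorem subspaceMass_top (g : V → ℝ) : subspaceMass g (⊤ : Submodule F V) = ∑ v, g v := by
  simp [subspaceMass]

theorem finrank_inf_ker_add_one {U : Submodule F V} {φ : Dual F V} (h : ¬ U ≤ φ.ker) :
    finrank F ↥(U ⊓ φ.ker) + 1 = finrank F U := by
  have h1 := (φ.domRestrict U).finrank_range_add_finrank_ker
  have h2 : (φ.domRestrict U) ≠ 0 := fun h0 => h fun u hu => by
    simpa using LinearMap.congr_fun h0 ⟨u, hu⟩
  have h3 : finrank F (φ.domRestrict U).range = 1 := by
    rw [LinearMap.range_eq_top.2 (LinearMap.surjective h2)]; simp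
  have h4 : finrank F (φ.domRestrict U).ker = finrank F ↥(U ⊓ φ.ker) := by
    have : (φ.domRestrict U).ker.map U.subtype = U ⊓ φ.ker := by
      ext x; simp [and_comm]
    rw [← this]
    exact (LinearEquiv.finrank_eq (Submodule.equivMapOfInjective _ U.injective_subtype _))
  omega

/-- Between two nested subspaces there is a hyperplane of the larger one. -/
theorem exists_finrank_add_one_eq {U S : Submodule F V} (h : U < S) :
    ∃ S', U ≤ S' ∧ S' ≤ S ∧ finrank F S' + 1 = finrank F S := by
  obtain ⟨v, hv, hvU⟩ := SetLike.exists_of_lt h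
  obtain ⟨φ, hφ, hU⟩ := Submodule.exists_le_ker_of_notMem hvU
  exact ⟨S ⊓ φ.ker, le_inf h.le hU, inf_le_left, finrank_inf_ker_add_one fun hS => hφ (hS hv)⟩

theorem exists_between_finrank_eq {U S : Submodule F V} (h : U ≤ S) {k : ℕ}
    (hU : finrank F U ≤ k) (hS : k ≤ finrank F S) :
    ∃ X, U ≤ X ∧ X ≤ S ∧ finrank F X = k := by
  obtain ⟨n, hn⟩ := Nat.exists_eq_add_of_le hS
  induction n generalizing S with
  | zero => exact ⟨S, h, le_rfl, hn⟩
  | succ n ih =>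
    obtain ⟨S', hUS', hS'S, hS'⟩ := exists_finrank_add_one_eq
      (lt_of_le_of_ne h (by rintro rfl; omega))
    obtain ⟨X, h1, h2, h3⟩ := ih hUS' (by omega) (by omega)
    exact ⟨X, h1, h2.trans hS'S, h3⟩

/-- The linear maps that vanish on a subspace are the linear maps on the quotient. -/
def quotientHomEquiv {W : Type*} [AddCommGroup W] [Module F W] (U : Submodule F V) :
    ((V ⧸ U) →ₗ[F] W) ≃ {ψ : V →ₗ[F] W // U ≤ ψ.ker} where
  toFun ψ := ⟨ψ ∘ₗ U.mkQ, fun u hu => by simp [(Submodule.Quotient.mk_eq_zero U).2 hu]⟩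
  invFun ψ := U.liftQ ψ.1 ψ.2
  left_inv ψ := by ext; simp
  right_inv ψ := by ext; simp

theorem natCard_hom_vanishing {W : Type*} [AddCommGroup W] [Module F W] [Module.Finite F W]
    (U : Submodule F V) :
    Nat.card {ψ : V →ₗ[F] W // U ≤ ψ.ker} =
      Fintype.card F ^ ((finrank F V - finrank F U) * finrank F W) := by
  rw [← Nat.card_congr (quotientHomEquiv U), Module.natCard_eq_pow_finrank (K := F),
    Module.finrank_linearMap, ← U.finrank_quotient_add_finrank, Nat.add_sub_cancel,
    Nat.card_eq_fintype_card]

theorem card_dual_vanishing [Fintype (Dual F V)] (U : Submodule F V) :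
    #{φ : Dual F V | U ≤ φ.ker} = Fintype.card F ^ (finrank F V - finrank F U) := by
  have := natCard_hom_vanishing (W := F) U
  rw [finrank_self, mul_one, Nat.card_eq_fintype_card, Fintype.card_subtype] at this
  exact this

/-- The masses of the hyperplanes of a subspace, summed over the functionals cutting them out. -/
theorem sum_subspaceMass_inf_ker [Fintype (Dual F V)] (g : V → ℝ) (hg : g 0 = 0)
    (U : Submodule F V) :
    ∑ φ : Dual F V with ¬ U ≤ φ.ker, subspaceMass g (U ⊓ φ.ker) =
      ((Fintype.card F : ℝ) ^ (finrank F V - 1) -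
        (Fintype.card F : ℝ) ^ (finrank F V - finrank F U)) * subspaceMass g U := by
  -- A nonzero vector is killed by q^(n-1) functionals, n = dim V; the zero vector is killed by all
  -- of them, hence the hypothesis `g 0 = 0`.
  have hall : ∑ φ : Dual F V, subspaceMass g (U ⊓ φ.ker) =
      (Fintype.card F : ℝ) ^ (finrank F V - 1) * subspaceMass g U := by
    simp only [subspaceMass]
    rw [sum_comm' (t' := ({v : V | v ∈ U} : Finset V))
      (s' := fun v => ({φ : Dual F V | F ∙ v ≤ φ.ker} : Finset (Dual F V)))
      (fun φ v => by simp [and_comm]), mul_sum]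
    refine sum_congr rfl fun v _ => ?_
    rw [sum_const, card_dual_vanishing, nsmul_eq_mul]
    by_cases hv : v = 0
    · simp [hv, hg]
    · rw [finrank_span_singleton hv]; push_cast; rfl
  have hin : ∑ φ : Dual F V with U ≤ φ.ker, subspaceMass g (U ⊓ φ.ker) =
      (Fintype.card F : ℝ) ^ (finrank F V - finrank F U) * subspaceMass g U := by
    rw [sum_congr rfl (g := fun _ => subspaceMass g U), sum_const, card_dual_vanishing]
    · simp
    · intro φ hφ
      rw [inf_eq_left.2 (by simpa using hφ)]
  have := sum_filter_add_sum_filter_not (univ : Finset (Dual F V)) (fun φ => U ≤ φ.ker)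
    (fun φ => subspaceMass g (U ⊓ φ.ker))
  rw [hall, hin] at this
  linarith

theorem finite_dual : Finite (Dual F V) := Module.finite_of_finite F

theorem pow_sub_pow_pos {n d : ℕ} (hd : 2 ≤ d) (hn : d ≤ n) :
    0 < (Fintype.card F : ℝ) ^ (n - 1) - (Fintype.card F : ℝ) ^ (n - d) := by
  have : (1 : ℝ) < Fintype.card F := by exact_mod_cast Fintype.one_lt_card
  exact sub_pos.2 (pow_lt_pow_right₀ this (by omega))

theorem subspaceMass_nonneg_of_hyperplanes (g : V → ℝ) (hg : g 0 = 0) (U : Submodule F V)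
    (hU : 2 ≤ finrank F U)
    (h : ∀ H ≤ U, finrank F H + 1 = finrank F U → 0 ≤ subspaceMass g H) :
    0 ≤ subspaceMass g U := by
  have := finite_dual (F := F) (V := V)
  let _ := Fintype.ofFinite (Dual F V)
  refine nonneg_of_mul_nonneg_right (a := (Fintype.card F : ℝ) ^ (finrank F V - 1) -
        (Fintype.card F : ℝ) ^ (finrank F V - finrank F U)) ?_
        (pow_sub_pow_pos hU U.finrank_le)
  rw [← sum_subspaceMass_inf_ker g hg U]
  refine sum_nonneg fun φ hφ => h _ inf_le_left (finrank_inf_ker_add_one (by simpa using hφ))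

theorem subspaceMass_eq_zero_of_hyperplanes (g : V → ℝ) (hg : g 0 = 0) (U : Submodule F V)
    (hU : 2 ≤ finrank F U)
    (h : ∀ H ≤ U, finrank F H + 1 = finrank F U → subspaceMass g H = 0) :
    subspaceMass g U = 0 := by
  have := finite_dual (F := F) (V := V)
  let _ := Fintype.ofFinite (Dual F V)
  refine (mul_eq_zero.1 ((sum_subspaceMass_inf_ker g hg U).symm.trans ?_)).resolve_left
    (pow_sub_pow_pos hU U.finrank_le).ne'
  exact sum_eq_zero fun φ hφ => h _ inf_le_left (finrank_inf_ker_add_one (by simpa using hφ))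

/-- If all hyperplanes of U had its mass, `sum_subspaceMass_inf_ker` would give q^(n-1) - q^(n-d)
functionals not vanishing on U, where n = dim V and d = dim U; there are q^n - q^(n-d). -/
theorem exists_hyperplane_subspaceMass_ne (g : V → ℝ) (hg : g 0 = 0) (U : Submodule F V)
    (hU : 2 ≤ finrank F U) (h0 : subspaceMass g U ≠ 0) :
    ∃ H ≤ U, finrank F H + 1 = finrank F U ∧ subspaceMass g H ≠ subspaceMass g U := by
  have := finite_dual (F := F) (V := V)
  let _ := Fintype.ofFinite (Dual F V)
  by_contra! h
  have h1 := sum_subspaceMass_inf_ker g hg U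
  rw [sum_congr rfl (g := fun _ => subspaceMass g U), sum_const, nsmul_eq_mul] at h1
  · have h2 := mul_right_cancel₀ h0 h1
    have h3 : (#{φ : Dual F V | ¬ U ≤ φ.ker} : ℝ) + #{φ : Dual F V | U ≤ φ.ker} =
        (Fintype.card F : ℝ) ^ finrank F V := by
      have h4 := card_filter_add_card_filter_not (s := (univ : Finset (Dual F V)))
        (fun φ => U ≤ φ.ker)
      have h5 : Fintype.card (Dual F V) = Fintype.card F ^ finrank F V := by
        rw [Module.card_eq_pow_finrank (K := F), Subspace.dual_finrank_eq]
      rw [card_univ, h5] at h4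
      rw [add_comm]
      exact_mod_cast h4
    rw [card_dual_vanishing] at h3
    push_cast at h3
    have h6 : (Fintype.card F : ℝ) ^ (finrank F V - 1) < (Fintype.card F : ℝ) ^ finrank F V := by
      refine pow_lt_pow_right₀ (by exact_mod_cast Fintype.one_lt_card) ?_
      have := U.finrank_le
      omega
    linarith
  · exact fun φ hφ => h _ inf_le_left (finrank_inf_ker_add_one (by simpa using hφ))

theorem eq_sup_span_singleton {S W : Submodule F V} {v : V} (hSW : S ≤ W) (hvW : v ∈ W)
    (hv : v ∉ S) (hW : finrank F W = finrank F S + 1) : W = S ⊔ F ∙ v := by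
  refine (Submodule.eq_of_le_of_finrank_eq (sup_le hSW (by simpa using hvW)) ?_).symm
  rw [Submodule.finrank_sup_span_singleton hv, hW]

variable [Fintype (Submodule F V)]

variable (F V) in
/-- The subspaces of a given dimension. -/
noncomputable def grassmannian (k : ℕ) : Finset (Submodule F V) := {W | finrank F W = k}

@[simp]
theorem mem_grassmannian {k : ℕ} {W : Submodule F V} :
    W ∈ grassmannian F V k ↔ finrank F W = k := by
  simp [grassmannian]

/-- The subspaces that lie between `S` and `T` and have dimension one more than `S`. -/
noncomputable def pencil (S T : Submodule F V) : Finset (Submodule F V) :=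
  {W | S ≤ W ∧ W ≤ T ∧ finrank F W = finrank F S + 1}

@[simp]
theorem mem_pencil {S T W : Submodule F V} :
    W ∈ pencil S T ↔ S ≤ W ∧ W ≤ T ∧ finrank F W = finrank F S + 1 := by
  simp [pencil]

/-- A vector of S lies in every member of the pencil, a vector of T outside S in exactly one: the
span of S and that vector. -/
theorem sum_pencil_subspaceMass (g : V → ℝ) {S T : Submodule F V} (h : S ≤ T) :
    ∑ W ∈ pencil S T, subspaceMass g W =
      ((#(pencil S T) : ℝ) - 1) * subspaceMass g S + subspaceMass g T := by
  have key : ∀ v : V, (#{W ∈ pencil S T | v ∈ W} : ℝ) =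
      ((#(pencil S T) : ℝ) - 1) * (if v ∈ S then 1 else 0) + (if v ∈ T then 1 else 0) := by
    intro v
    by_cases hS : v ∈ S
    · rw [if_pos hS, if_pos (h hS), filter_true_of_mem fun W hW => (mem_pencil.1 hW).1 hS]
      ring
    · by_cases hT : v ∈ T
      · have : {W ∈ pencil S T | v ∈ W} = {S ⊔ F ∙ v} := by
          ext W
          simp only [mem_filter, mem_pencil, mem_singleton]
          constructor
          · rintro ⟨⟨h1, h2, h3⟩, h4⟩
            exact eq_sup_span_singleton h1 h4 hS h3
          · rintro rfl
            exact ⟨⟨le_sup_left, sup_le h (by simpa using hT),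
              Submodule.finrank_sup_span_singleton hS⟩,
              Submodule.mem_sup_right (Submodule.mem_span_singleton_self v)⟩
        rw [this, if_neg hS, if_pos hT]; simp
      · rw [filter_false_of_mem fun W hW hv => hT ((mem_pencil.1 hW).2.1 hv), if_neg hS, if_neg hT]
        simp
  simp only [subspaceMass]
  rw [sum_comm' (t' := univ) (s' := fun v => {W ∈ pencil S T | v ∈ W}) (fun W v => by simp)]
  simp only [sum_const, nsmul_eq_mul, key, add_mul, mul_assoc, sum_add_distrib, ← mul_sum, ite_mul,
    one_mul, zero_mul, sum_filter]

theorem card_pencil {S T : Submodule F V} (h : S ≤ T) :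
    (#(pencil S T) : ℝ) * (Fintype.card F : ℝ) ^ (finrank F S + 1) =
      ((#(pencil S T) : ℝ) - 1) * (Fintype.card F : ℝ) ^ finrank F S +
        (Fintype.card F : ℝ) ^ finrank F T := by
  rw [← subspaceMass_one, ← subspaceMass_one, ← sum_pencil_subspaceMass _ h,
    sum_congr rfl (g := fun _ => (Fintype.card F : ℝ) ^ (finrank F S + 1)), sum_const, nsmul_eq_mul]
  intro W hW
  rw [subspaceMass_one, (mem_pencil.1 hW).2.2]

end SubspaceSums

/-! ### The complement equation forces degree one -/

section Degree

variable {F V : Type*} [Field F] [Fintype F] [AddCommGroup V] [Module F V] [Fintype V]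
  [Fintype (Submodule F V)]

/-- The sum of `f` over the `t`-dimensional subspaces that contain `S`. -/
noncomputable def sumAbove (t : ℕ) (f : Submodule F V → ℝ) (S : Submodule F V) : ℝ :=
  ∑ W ∈ grassmannian F V t with S ≤ W, f W

/-- The sum of `f` over the `t`-dimensional subspaces that meet `S` exactly in `U`. -/
noncomputable def sumMeeting (t : ℕ) (f : Submodule F V → ℝ) (S U : Submodule F V) : ℝ :=
  ∑ W ∈ grassmannian F V t with W ⊓ S = U, f W

/-- The sum of `f` over the `t`-dimensional complements of `W₀`. -/
noncomputable def sumCompl (t : ℕ) (f : Submodule F V → ℝ) (W₀ : Submodule F V) : ℝ :=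
  ∑ W ∈ grassmannian F V t with IsCompl W₀ W, f W

theorem sumMeeting_self (t : ℕ) (f : Submodule F V → ℝ) (S : Submodule F V) :
    sumMeeting t f S S = sumAbove t f S := by
  simp only [sumMeeting, sumAbove, inf_eq_right]

theorem card_pencil_sdiff {U S S' : Submodule F V} {d : ℕ} (hU : U ≤ S') (hS : S' ≤ S)
    (h : finrank F S' + 1 = finrank F S) (hd : finrank F S' = finrank F U + d) :
    (#(pencil U S \ pencil U S') : ℝ) = (Fintype.card F : ℝ) ^ d := by
  have hsub : pencil U S' ⊆ pencil U S := fun W hW => by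
    simp only [mem_pencil] at hW ⊢
    exact ⟨hW.1, hW.2.1.trans hS, hW.2.2⟩
  rw [cast_card_sdiff hsub]
  have h1 := card_pencil (hU.trans hS)
  have h2 := card_pencil hU
  have hq : (1 : ℝ) < Fintype.card F := by exact_mod_cast Fintype.one_lt_card
  rw [← h, hd] at h1
  rw [hd] at h2
  have h3 : 0 < (Fintype.card F : ℝ) ^ finrank F U * ((Fintype.card F : ℝ) - 1) :=
    mul_pos (pow_pos (by linarith) _) (by linarith)
  refine mul_right_cancel₀ h3.ne' ?_
  simp only [pow_add, pow_one] at h1 h2 ⊢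
  linarith

/-- Sort the W with W ⊓ S' = U by W ⊓ S. As S' is a hyperplane of S, this intersection is U or
exceeds it by one dimension, and then it is not inside S'. -/
theorem sumMeeting_eq_add {t : ℕ} (f : Submodule F V → ℝ) {U S S' : Submodule F V}
    (hU : U ≤ S') (hS : S' ≤ S) (h : finrank F S' + 1 = finrank F S) :
    sumMeeting t f S' U =
      sumMeeting t f S U + ∑ X ∈ pencil U S \ pencil U S', sumMeeting t f S X := by
  have hnot : U ∉ pencil U S \ pencil U S' := by simp
  rw [← sum_insert hnot, sumMeeting,
    ← sum_fiberwise_of_maps_to (t := insert U (pencil U S \ pencil U S')) (g := fun W => W ⊓ S)]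
  · refine sum_congr rfl fun X hX => ?_
    have hXU : X ⊓ S' = U := by
      rcases mem_insert.1 hX with rfl | hX
      · exact inf_eq_left.2 hU
      · simp only [mem_sdiff, mem_pencil, not_and] at hX
        obtain ⟨⟨h1, h2, h3⟩, h4⟩ := hX
        have hlt : X ⊓ S' < X := lt_of_le_of_ne inf_le_left fun he =>
          h4 h1 (inf_eq_left.1 he) h3
        refine (Submodule.eq_of_le_of_finrank_le (le_inf h1 hU) ?_).symm
        have := Submodule.finrank_lt_finrank_of_lt hlt
        omega
    rw [sumMeeting, filter_filter]
    refine sum_congr (filter_congr fun W _ => ⟨fun h => h.2, fun h => ⟨?_, h⟩⟩) fun _ _ => rfl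
    rw [← hXU, ← h, inf_assoc, inf_eq_right.2 hS]
  · intro W hW
    have hWU : W ⊓ S' = U := (mem_filter.1 hW).2
    have hmeet : (W ⊓ S) ⊓ S' = U := by rw [inf_assoc, inf_eq_right.2 hS, hWU]
    have hle : U ≤ W ⊓ S := hmeet ▸ inf_le_left
    rw [mem_insert]
    by_cases he : W ⊓ S = U
    · exact Or.inl he
    · right
      have h1 := Submodule.finrank_sup_add_finrank_inf_eq (W ⊓ S) S'
      rw [hmeet] at h1
      have h2 := Submodule.finrank_mono (sup_le inf_le_right hS : (W ⊓ S) ⊔ S' ≤ S)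
      have h3 := Submodule.finrank_lt_finrank_of_lt (lt_of_le_of_ne hle (Ne.symm he))
      simp only [mem_sdiff, mem_pencil, not_and]
      exact ⟨⟨hle, inf_le_right, by omega⟩, fun _ h4 => absurd (hmeet ▸ (inf_eq_left.2 h4).symm) he⟩

/-- Möbius inversion in the lattice of subspaces, when only the top term survives. -/
theorem sumMeeting_eq_of_sumAbove_eq_zero (t : ℕ) (f : Submodule F V → ℝ) (d : ℕ) :
    ∀ U S : Submodule F V, U ≤ S → finrank F S = finrank F U + d →
      (∀ S', U ≤ S' → S' < S → sumAbove t f S' = 0) →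
      sumMeeting t f S U = (-1) ^ d * (Fintype.card F : ℝ) ^ d.choose 2 * sumAbove t f S := by
  induction d with
  | zero =>
    intro U S hUS hd _
    obtain rfl := Submodule.eq_of_le_of_finrank_eq hUS hd.symm
    simp [sumMeeting_self]
  | succ d ih =>
    intro U S hUS hd h0
    have hlt : U < S := lt_of_le_of_ne hUS (by rintro rfl; omega)
    obtain ⟨S', hU, hS, hS'⟩ := exists_finrank_add_one_eq hlt
    have hS'lt : S' < S := lt_of_le_of_ne hS (by rintro rfl; omega)
    have h1 := ih U S' hU (by omega) fun X hX hXS => h0 X hX (hXS.trans hS'lt)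
    -- The sum for S' vanishes; splitting it leaves the sum for S plus q^d terms that all have the
    -- same value by induction.
    rw [h0 S' hU hS'lt, mul_zero, sumMeeting_eq_add f hU hS hS',
      sum_congr rfl (g := fun _ => (-1) ^ d * (Fintype.card F : ℝ) ^ d.choose 2 * sumAbove t f S),
      sum_const, nsmul_eq_mul, card_pencil_sdiff (d := d) hU hS hS' (by omega)] at h1
    · rw [show (d + 1).choose 2 = d + d.choose 2 by
        rw [Nat.choose_succ_succ' d 1, Nat.choose_one_right], pow_add (Fintype.card F : ℝ), pow_succ (-1 : ℝ)]
      linarith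
    · intro X hX
      obtain ⟨h2, h3, h4⟩ := mem_pencil.1 (mem_sdiff.1 hX).1
      exact ih X S h3 (by omega) fun Y hY hYS => h0 Y (h2.trans hY) hYS

/-- The complements of `W` that contain a given subspace disjoint from `W`. -/
theorem natCard_compl_above {W S : Submodule F V} (h : Disjoint W S) :
    Nat.card {X : Submodule F V // IsCompl W X ∧ S ≤ X} =
      Fintype.card F ^ ((finrank F V - (finrank F W + finrank F S)) * finrank F W) := by
  obtain ⟨X₀, hSX, hX₀⟩ := h.symm.exists_isCompl
  set π := (W.isComplEquivProj ⟨X₀, hX₀.symm⟩).1 with hπdef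
  have hπW : ∀ x : W, π x = x := (W.isComplEquivProj ⟨X₀, hX₀.symm⟩).2
  have hπS : S ≤ π.ker := by
    rw [hπdef, Submodule.coe_isComplEquivProj_apply, Submodule.ker_projectionOnto]
    exact hSX
  -- The complements of W above S are the kernels of the projections onto W that kill S; subtracting
  -- the fixed one π turns these into the maps vanishing on W ⊔ S.
  have e : {X : Submodule F V // IsCompl W X ∧ S ≤ X} ≃
      {ψ : V →ₗ[F] W // W ⊔ S ≤ ψ.ker} :=
    { toFun := fun X => ⟨(W.isComplEquivProj ⟨X.1, X.2.1⟩).1 - π, sup_le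
        (fun w hw => by
          have h1 := (W.isComplEquivProj ⟨X.1, X.2.1⟩).2 ⟨w, hw⟩
          have h2 := hπW ⟨w, hw⟩
          simp only at h1 h2
          rw [LinearMap.mem_ker, LinearMap.sub_apply, h1, h2, sub_self])
        (fun s hs => by
          have h1 : (W.isComplEquivProj ⟨X.1, X.2.1⟩).1 s = 0 := by
            rw [← LinearMap.mem_ker, Submodule.coe_isComplEquivProj_apply,
              Submodule.ker_projectionOnto]
            exact X.2.2 hs
          have h2 : π s = 0 := hπS hs
          rw [LinearMap.mem_ker, LinearMap.sub_apply, h1, h2, sub_zero])⟩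
      invFun := fun ψ => ⟨(ψ.1 + π).ker,
        LinearMap.isCompl_of_proj fun x => by
          have := ψ.2 (Submodule.mem_sup_left x.2)
          rw [LinearMap.mem_ker] at this
          rw [LinearMap.add_apply, this, zero_add, hπW],
        fun s hs => by
          have h1 := ψ.2 (Submodule.mem_sup_right hs)
          have h2 : π s = 0 := hπS hs
          rw [LinearMap.mem_ker] at h1 ⊢
          rw [LinearMap.add_apply, h1, h2, zero_add]⟩
      left_inv := fun X => by
        ext1
        simp only [sub_add_cancel, Submodule.coe_isComplEquivProj_apply,
          Submodule.ker_projectionOnto]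
      right_inv := fun ψ => by
        ext1
        have hX : ∀ x : W, (ψ.1 + π) x = x := fun x => by
          have := ψ.2 (Submodule.mem_sup_left x.2)
          rw [LinearMap.mem_ker] at this
          rw [LinearMap.add_apply, this, zero_add, hπW]
        have := W.isComplEquivProj.apply_symm_apply ⟨ψ.1 + π, hX⟩
        rw [Subtype.ext_iff] at this
        exact sub_eq_iff_eq_add.2 this }
  rw [Nat.card_congr e, natCard_hom_vanishing]
  have := Submodule.finrank_sup_add_finrank_inf_eq W S
  rw [h.eq_bot, finrank_bot] at this
  rw [← this, add_zero]

theorem card_compl_above {t : ℕ} (hV : finrank F V = 2 * t) {W S : Submodule F V}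
    (hW : finrank F W = t) (h : Disjoint W S) :
    #{X ∈ grassmannian F V t | IsCompl W X ∧ S ≤ X} =
      Fintype.card F ^ ((t - finrank F S) * t) := by
  have h1 := natCard_compl_above h
  rw [Nat.card_eq_fintype_card, Fintype.card_subtype, hV, hW,
    show 2 * t - (t + finrank F S) = t - finrank F S by omega] at h1
  rw [← h1]
  congr 1
  ext X
  simp only [mem_filter, mem_grassmannian, mem_univ, true_and, and_iff_right_iff_imp]
  rintro ⟨hX, -⟩
  have := Submodule.finrank_add_eq_of_isCompl hX
  omega

/-- Double counting: W has q^((t - dim S)t) complements above S if it is disjoint from S, and none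
otherwise. Combined with the complement equation, this ties `sumMeeting` to `sumAbove` a second
time, besides Möbius inversion. -/
theorem sum_sumCompl_above {t : ℕ} (hV : finrank F V = 2 * t) (f : Submodule F V → ℝ)
    (S : Submodule F V) :
    ∑ W₀ ∈ grassmannian F V t with S ≤ W₀, sumCompl t f W₀ =
      (Fintype.card F : ℝ) ^ ((t - finrank F S) * t) * sumMeeting t f S ⊥ := by
  simp only [sumCompl, sumMeeting]
  rw [sum_comm' (t' := grassmannian F V t)
    (s' := fun W => {X ∈ grassmannian F V t | IsCompl W X ∧ S ≤ X})
    (fun X W => by simp only [mem_filter, isCompl_comm (x := X)]; tauto), mul_sum, sum_filter]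
  refine sum_congr rfl fun W hW => ?_
  rw [sum_const, nsmul_eq_mul]
  split_ifs with h
  · rw [card_compl_above hV (mem_grassmannian.1 hW) (disjoint_iff.2 h)]
    push_cast; rfl
  · rw [filter_false_of_mem, card_empty, Nat.cast_zero, zero_mul]
    exact fun X _ hX => h (disjoint_iff.1 (hX.1.disjoint.mono_right hX.2))

/-- A vector outside W₀ lies in q^((t-1)t) complements of W₀, a nonzero vector of W₀ in none. Masses
therefore satisfy the complement equation of a colour class, with the total weight in place of 1. -/
theorem sumCompl_subspaceMass {t : ℕ} (hV : finrank F V = 2 * t) (g : V → ℝ) (hg : g 0 = 0)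
    {W₀ : Submodule F V} (hW₀ : finrank F W₀ = t) :
    sumCompl t (subspaceMass g) W₀ =
      (Fintype.card F : ℝ) ^ ((t - 1) * t) * (∑ v, g v - subspaceMass g W₀) := by
  have hsplit : ∑ v, g v - subspaceMass g W₀ = ∑ v with v ∉ W₀, g v := by
    rw [subspaceMass, ← sum_filter_add_sum_filter_not univ (fun v => v ∈ W₀), add_sub_cancel_left]
  rw [hsplit]
  simp only [sumCompl, subspaceMass]
  rw [sum_comm' (t' := univ)
    (s' := fun v => {X ∈ grassmannian F V t | IsCompl W₀ X ∧ F ∙ v ≤ X})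
    (fun X v => by simp [and_assoc]), mul_sum, sum_filter]
  refine sum_congr rfl fun v _ => ?_
  rw [sum_const, nsmul_eq_mul]
  by_cases hv : v = 0
  · simp [hv, hg]
  split_ifs with h
  · rw [filter_false_of_mem, card_empty, Nat.cast_zero, zero_mul]
    intro X _ hX
    refine hv (Submodule.disjoint_def.1 hX.1.disjoint v h ?_)
    exact hX.2 (Submodule.mem_span_singleton_self v)
  · rw [card_compl_above hV hW₀, finrank_span_singleton hv]
    · push_cast; rfl
    · rw [Submodule.disjoint_span_singleton' hv]
      exact h

/-- A function on `t`-dimensional subspaces is, up to the values of a mass, orthogonal to all the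
functions that indicate the subspaces through a given vector. -/
theorem exists_subspaceMass_residual (t : ℕ) (f : Submodule F V → ℝ) :
    ∃ g : V → ℝ, g 0 = 0 ∧ ∀ v ≠ 0,
      ∑ W ∈ grassmannian F V t with v ∈ W, (f W - subspaceMass g W) = 0 := by
  let b : {v : V // v ≠ 0} → EuclideanSpace ℝ {W : Submodule F V // finrank F W = t} := fun v => WithLp.toLp 2 fun W => if v.1 ∈ W.1 then 1 else 0
  -- Orthogonal projection to the span of the indicators `b v`; the coefficients of the projection
  -- are the weight g.
  obtain ⟨y, hy, z, hz, hyz⟩ := (Submodule.span ℝ (Set.range b)).exists_add_mem_mem_orthogonal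
    (WithLp.toLp 2 fun W => f W.1)
  obtain ⟨c, rfl⟩ := (Submodule.mem_span_range_iff_exists_fun ℝ).1 hy
  refine ⟨fun v => if h : v = 0 then 0 else c ⟨v, h⟩, by simp, fun v hv => ?_⟩
  have h1 := hz (b ⟨v, hv⟩) (Submodule.subset_span ⟨_, rfl⟩)
  have hzW : ∀ W : {W : Submodule F V // finrank F W = t}, z W = f W.1 -
      subspaceMass (fun v => if h : v = 0 then 0 else c ⟨v, h⟩) W.1 := by
    intro W
    have h2 : f W.1 = (∑ i, c i • b i) W + z W := congrFun (congrArg WithLp.ofLp hyz) W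
    have h3 : (∑ i, c i • b i) W =
        subspaceMass (fun v => if h : v = 0 then 0 else c ⟨v, h⟩) W.1 := by
      simp only [WithLp.ofLp_sum, Finset.sum_apply, WithLp.ofLp_smul, Pi.smul_apply, smul_eq_mul, b,
        mul_ite, mul_one, mul_zero, subspaceMass]
      rw [sum_filter, ← sum_filter_add_sum_filter_not univ (fun v : V => v = 0)]
      rw [sum_eq_zero (s := {v : V | v = 0}) (by intro v hv; simp [(mem_filter.1 hv).2]), zero_add,
        ← sum_subtype_eq_sum_filter]
      rw [show (Finset.subtype (fun v : V => ¬ v = 0) univ) = univ by ext; simp]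
      refine sum_congr rfl fun v _ => ?_
      rw [dif_neg v.2]
    rw [h2, h3]; ring
  rw [PiLp.inner_apply] at h1
  refine Eq.trans ?_ h1
  rw [grassmannian, filter_filter, ← filter_filter, sum_filter,
    ← sum_subtype_eq_sum_filter]
  rw [show (Finset.subtype (fun W : Submodule F V => finrank F W = t) univ) = univ by ext; simp]
  refine sum_congr rfl fun W _ => ?_
  rw [hzW W]
  simp [b]

theorem eq_subspaceMass_of_sumCompl {t : ℕ} (ht : 1 ≤ t) (hV : finrank F V = 2 * t)
    (f : Submodule F V → ℝ)
    (hf : ∀ W₀ ∈ grassmannian F V t,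
      sumCompl t f W₀ = (Fintype.card F : ℝ) ^ ((t - 1) * t) * (1 - f W₀)) :
    ∃ g : V → ℝ, g 0 = 0 ∧ ∑ v, g v = 1 ∧ ∀ W ∈ grassmannian F V t, f W = subspaceMass g W := by
  obtain ⟨g, hg, hres⟩ := exists_subspaceMass_residual t f
  have hq : (1 : ℝ) < Fintype.card F := by exact_mod_cast Fintype.one_lt_card
  set q : ℝ := (Fintype.card F : ℝ) with hqdef
  set f₀ : Submodule F V → ℝ := fun W => f W - subspaceMass g W with hf₀
  have hcompl : ∀ W₀ ∈ grassmannian F V t,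
      sumCompl t f₀ W₀ = q ^ ((t - 1) * t) * (1 - ∑ v, g v) - q ^ ((t - 1) * t) * f₀ W₀ := by
    intro W₀ hW₀
    have h1 : sumCompl t f₀ W₀ = sumCompl t f W₀ - sumCompl t (subspaceMass g) W₀ :=
      sum_sub_distrib ..
    rw [h1, hf W₀ hW₀, sumCompl_subspaceMass hV g hg (mem_grassmannian.1 hW₀)]
    simp only [hf₀]; ring
  have hbot : sumAbove t f₀ ⊥ = 0 := by
    -- Summing the orthogonality relations over v ≠ 0 counts every W exactly q^t - 1 times.
    have h1 : ∑ v : V with v ≠ 0, ∑ W ∈ grassmannian F V t with v ∈ W, f₀ W =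
        (q ^ t - 1) * sumAbove t f₀ ⊥ := by
      rw [sum_comm' (t' := grassmannian F V t) (s' := fun W => ({v : V | v ∈ W} : Finset V).erase 0)
        (fun v W => by simp only [mem_filter, mem_univ, mem_erase]; tauto)]
      rw [sumAbove, filter_true_of_mem (fun W _ => bot_le), mul_sum]
      refine sum_congr rfl fun W hW => ?_
      rw [sum_const, card_erase_of_mem (by simp), card_filter_mem_submodule, mem_grassmannian.1 hW,
        nsmul_eq_mul, Nat.cast_sub (Nat.one_le_pow _ _ Fintype.card_pos)]
      push_cast; rfl
    rw [sum_eq_zero fun v hv => hres v (by simpa using hv)] at h1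
    refine (mul_eq_zero.1 h1.symm).resolve_left (sub_pos.2 ?_).ne'
    exact one_lt_pow₀ hq (by omega)
  have hne : (grassmannian F V t).Nonempty := by
    obtain ⟨W, -, -, hW⟩ := exists_between_finrank_eq (F := F) (V := V) (bot_le : ⊥ ≤ ⊤) (k := t)
      (by simp) (by rw [finrank_top]; omega)
    exact ⟨W, mem_grassmannian.2 hW⟩
  -- Sum the equation `hcompl` over all W₀: the residual has total 0, so the constant term must
  -- vanish.
  have hone : ∑ v, g v = 1 := by
    have h1 := sum_sumCompl_above hV f₀ ⊥
    rw [sumMeeting_self, hbot, mul_zero, filter_true_of_mem (fun W _ => bot_le),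
      sum_congr rfl hcompl, sum_sub_distrib, ← mul_sum, ← mul_sum, sum_const, nsmul_eq_mul] at h1
    rw [sumAbove, filter_true_of_mem (fun W _ => bot_le)] at hbot
    rw [hbot, mul_zero, sub_zero] at h1
    have h2 : (0 : ℝ) < #(grassmannian F V t) := by exact_mod_cast hne.card_pos
    have h3 : 0 < q ^ ((t - 1) * t) := pow_pos (by linarith) _
    have h4 := (mul_eq_zero.1 ((mul_eq_zero.1 h1).resolve_left h3.ne')).resolve_left h2.ne'
    linarith
  have hrel : ∀ S : Submodule F V, q ^ ((t - finrank F S) * t) * sumMeeting t f₀ S ⊥ =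
      - (q ^ ((t - 1) * t) * sumAbove t f₀ S) := by
    intro S
    rw [← sum_sumCompl_above hV, sumAbove, mul_sum, ← sum_neg_distrib]
    refine sum_congr rfl fun W hW => ?_
    rw [hcompl W (mem_filter.1 hW).1, hone]; ring
  have hzero : ∀ r, ∀ S : Submodule F V, finrank F S = r → r ≤ t → sumAbove t f₀ S = 0 := by
    intro r
    induction r using Nat.strong_induction_on with
    | _ r ih =>
      intro S hS hr
      have hM := sumMeeting_eq_of_sumAbove_eq_zero t f₀ r ⊥ S bot_le (by simp [hS])
        fun S' _ hlt => by
          have := Submodule.finrank_lt_finrank_of_lt hlt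
          exact ih _ (by omega) S' rfl (by omega)
      rcases Nat.lt_or_ge r 2 with h2 | h2
      · obtain rfl | rfl : r = 0 ∨ r = 1 := by omega
        · rw [Submodule.finrank_eq_zero.1 hS, hbot]
        · obtain ⟨⟨v, hvS⟩, hv, -⟩ := finrank_eq_one_iff'.1 hS
          replace hv : v ≠ 0 := by simpa using hv
          have hSv : S = F ∙ v := by
            refine (Submodule.eq_of_le_of_finrank_eq (by simpa using hvS) ?_).symm
            rw [hS, finrank_span_singleton hv]
          rw [sumAbove, ← hres v hv, hSv]
          simp only [Submodule.span_singleton_le_iff_mem, hf₀]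
      · have h3 := hrel S
        rw [hM, hS] at h3
        by_contra hne0
        -- A nonzero sum would make the factors from Möbius inversion and from `hrel` agree. Then r
        -- is odd and (t-r)t + r(r-1)/2 = (t-1)t, that is r = 2t since r ≥ 2, contrary to r ≤ t.
        have h4 : q ^ ((t - r) * t + r.choose 2) * (-1) ^ r = - q ^ ((t - 1) * t) := by
          refine mul_right_cancel₀ hne0 ?_
          rw [pow_add]; linarith
        rcases neg_one_pow_eq_or ℝ r with h5 | h5
        · rw [h5, mul_one] at h4
          have h6 : 0 < q ^ ((t - r) * t + r.choose 2) := pow_pos (by linarith) _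
          have h7 : 0 < q ^ ((t - 1) * t) := pow_pos (by linarith) _
          linarith
        · rw [h5, mul_neg_one, neg_inj] at h4
          have h6 := pow_right_injective₀ (by linarith) hq.ne' h4
          have h7 : r.choose 2 * 2 = r * (r - 1) := by
            rw [Nat.choose_two_right, Nat.div_mul_cancel (Nat.even_mul_pred_self r).two_dvd]
          obtain ⟨k, rfl⟩ := Nat.exists_eq_add_of_le hr
          obtain ⟨m, rfl⟩ := Nat.exists_eq_add_of_le h2
          simp only [show 2 + m + k - (2 + m) = k by omega, show 2 + m + k - 1 = 1 + m + k by omega,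
            show 2 + m - 1 = 1 + m by omega] at h6 h7
          nlinarith
  refine ⟨g, hg, hone, fun W hW => ?_⟩
  have hW' := mem_grassmannian.1 hW
  have h1 := hzero t W hW' le_rfl
  have h2 : {X ∈ grassmannian F V t | W ≤ X} = {W} := by
    ext X
    simp only [mem_filter, mem_grassmannian, mem_singleton]
    constructor
    · rintro ⟨hX, hWX⟩
      exact (Submodule.eq_of_le_of_finrank_eq hWX (hW'.trans hX.symm)).symm
    · rintro rfl
      exact ⟨hW', le_rfl⟩
  rw [sumAbove, h2, sum_singleton] at h1
  exact sub_eq_zero.1 h1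

end Degree

/-! ### Spreads, and averaging over them -/

section Spread

variable {F V : Type*} [Field F] [Fintype F] [AddCommGroup V] [Module F V] [Fintype V]

/-- An additive family of linear maps `V → W₀`, of size `|F| ^ t`, such that the kernel of every
nonzero member is `W₀`. It comes from multiplication in the extension of `F` of degree `t`. -/
theorem exists_additive_family {t : ℕ} (ht : 1 ≤ t) (hV : finrank F V = 2 * t)
    {W₀ : Submodule F V} (hW₀ : finrank F W₀ = t) :
    ∃ (L : Type) (_ : AddCommGroup L) (_ : Fintype L) (ψ : L →+ (V →ₗ[F] W₀)),
      Fintype.card L = Fintype.card F ^ t ∧ ∀ k ≠ 0, (ψ k).ker = W₀ := by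
  obtain ⟨p, hp⟩ := CharP.exists F
  have : Fact p.Prime := ⟨CharP.char_is_prime F p⟩
  have : NeZero t := ⟨by omega⟩
  let L := FiniteField.Extension F p t
  have hL : finrank F L = t := FiniteField.finrank_extension F p t
  have : Finite L := Module.finite_of_finite F
  let _ := Fintype.ofFinite L
  have hQ : finrank F (V ⧸ W₀) = t := by
    have := W₀.finrank_quotient_add_finrank
    omega
  let e : W₀ ≃ₗ[F] L := LinearEquiv.ofFinrankEq _ _ (hW₀.trans hL.symm)
  let e' : (V ⧸ W₀) ≃ₗ[F] L := LinearEquiv.ofFinrankEq _ _ (hQ.trans hL.symm)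
  refine ⟨L, inferInstance, inferInstance, AddMonoidHom.mk'
    (fun k => e.symm.toLinearMap ∘ₗ LinearMap.mulLeft F k ∘ₗ e'.toLinearMap ∘ₗ W₀.mkQ)
    (fun a b => by ext v; simp [add_mul]), ?_, fun k hk => ?_⟩
  · rw [Module.card_eq_pow_finrank (K := F), hL]
  · ext v
    simp [LinearMap.mem_ker, hk]

/-- A vector in both kernels is killed by the difference, so it lies in W₀, where π is the identity.
-/
theorem isCompl_ker_of_ker_sub_eq {t : ℕ} (hV : finrank F V = 2 * t)
    {W₀ : Submodule F V} (hW₀ : finrank F W₀ = t) {π π' : V →ₗ[F] W₀}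
    (hπ : ∀ x : W₀, π x = x) (hπ' : ∀ x : W₀, π' x = x) (h : (π' - π).ker = W₀) :
    IsCompl π.ker π'.ker := by
  have h1 := Submodule.finrank_add_eq_of_isCompl (LinearMap.isCompl_of_proj hπ)
  have h2 := Submodule.finrank_add_eq_of_isCompl (LinearMap.isCompl_of_proj hπ')
  have hdis : Disjoint π.ker π'.ker := by
    rw [Submodule.disjoint_def]
    intro v hv hv'
    rw [LinearMap.mem_ker] at hv hv'
    have hvW : v ∈ W₀ := by
      rw [← h, LinearMap.mem_ker, LinearMap.sub_apply, hv, hv', sub_zero]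
    have := hπ ⟨v, hvW⟩
    rw [hv] at this
    exact (Subtype.ext_iff.1 this).symm
  refine ⟨hdis, codisjoint_iff.2 (Submodule.eq_top_of_finrank_eq ?_)⟩
  have h3 := Submodule.finrank_sup_add_finrank_inf_eq π.ker π'.ker
  rw [hdis.eq_bot, finrank_bot] at h3
  omega

variable [Fintype (Submodule F V)]

theorem sumCompl_eq_sum_proj {t : ℕ} (hV : finrank F V = 2 * t) {W₀ : Submodule F V}
    (hW₀ : finrank F W₀ = t) [Fintype {π : V →ₗ[F] W₀ // ∀ x : W₀, π x = x}]
    (f : Submodule F V → ℝ) :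
    sumCompl t f W₀ = ∑ π : {π : V →ₗ[F] W₀ // ∀ x : W₀, π x = x}, f π.1.ker := by
  rw [← Fintype.sum_equiv W₀.isComplEquivProj.symm (fun π => f π.1.ker) (fun X => f X.1)
    (fun _ => rfl) |>.symm, sumCompl, grassmannian, filter_filter]
  refine sum_subtype _ (fun X => ?_) f
  simp only [mem_filter, mem_univ, true_and, and_iff_right_iff_imp]
  intro hX
  have := Submodule.finrank_add_eq_of_isCompl hX
  omega

theorem natCard_proj {t : ℕ} (hV : finrank F V = 2 * t) {W₀ : Submodule F V}
    (hW₀ : finrank F W₀ = t) :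
    Nat.card {π : V →ₗ[F] W₀ // ∀ x : W₀, π x = x} = Fintype.card F ^ (t * t) := by
  have h1 := natCard_compl_above (disjoint_bot_right (a := W₀))
  rw [hV, hW₀, finrank_bot, show 2 * t - (t + 0) = t by omega] at h1
  rw [← h1]
  refine Nat.card_congr (W₀.isComplEquivProj.symm.trans (Equiv.subtypeEquivRight fun X => ?_))
  simp

/-- The indicator function of a colour class. -/
noncomputable def classIndicator {κ : Type*} (c : Submodule F V → κ) (C : κ)
    (W : Submodule F V) : ℝ :=
  if c W = C then 1 else 0

/-- If the `t`-dimensional subspaces are coloured with at most `|F| ^ t + 1` colours such that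
complementary subspaces get distinct colours, then every colour occurs exactly once in every
spread. -/
theorem sumCompl_classIndicator {t : ℕ} (ht : 1 ≤ t) (hV : finrank F V = 2 * t)
    {κ : Type*} [Fintype κ] (hκ : Fintype.card κ ≤ Fintype.card F ^ t + 1)
    (c : Submodule F V → κ)
    (hc : ∀ W W' : Submodule F V, finrank F W = t → finrank F W' = t → IsCompl W W' → c W ≠ c W')
    (C : κ) (W₀ : Submodule F V) (hW₀ : finrank F W₀ = t) :
    sumCompl t (classIndicator c C) W₀ =
      (Fintype.card F : ℝ) ^ ((t - 1) * t) * (1 - classIndicator c C W₀) := by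
  obtain ⟨L, _, _, ψ, hL, hψ⟩ := exists_additive_family ht hV hW₀
  have hψ0 : ∀ k, ∀ x : W₀, ψ k x = 0 := by
    intro k x
    by_cases hk : k = 0
    · simp [hk]
    · rw [← LinearMap.mem_ker, hψ k hk]
      exact x.2
  have : Finite (V →ₗ[F] W₀) := Module.finite_of_finite F
  let _ := Fintype.ofFinite {π : V →ₗ[F] W₀ // ∀ x : W₀, π x = x}
  let shift : L → {π : V →ₗ[F] W₀ // ∀ x : W₀, π x = x} ≃
      {π : V →ₗ[F] W₀ // ∀ x : W₀, π x = x} := fun k =>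
    { toFun := fun π => ⟨π.1 + ψ k, fun x => by
        rw [LinearMap.add_apply, hψ0, add_zero, π.2]⟩
      invFun := fun π => ⟨π.1 - ψ k, fun x => by
        rw [LinearMap.sub_apply, hψ0, sub_zero, π.2]⟩
      left_inv := fun π => by simp
      right_inv := fun π => by simp }
  have hdim : ∀ π : {π : V →ₗ[F] W₀ // ∀ x : W₀, π x = x}, finrank F π.1.ker = t := by
    intro π
    have := Submodule.finrank_add_eq_of_isCompl (LinearMap.isCompl_of_proj π.2)
    omega
  have hspread : ∀ π : {π : V →ₗ[F] W₀ // ∀ x : W₀, π x = x},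
      ∑ k, classIndicator c C (shift k π).1.ker = 1 - classIndicator c C W₀ := by
    intro π
    -- W₀ and the kernels of π + ψ k form a spread of q^t + 1 members. Their colours are distinct,
    -- so with this few colours available every colour occurs once.
    let s : Option L → κ := fun o => o.elim (c W₀) fun k => c (shift k π).1.ker
    have hinj : Function.Injective s := by
      rintro (_ | k) (_ | k') h
      · rfl
      · exact absurd h (hc _ _ hW₀ (hdim _) (LinearMap.isCompl_of_proj (shift k' π).2))
      · exact absurd h (hc _ _ (hdim _) hW₀ (LinearMap.isCompl_of_proj (shift k π).2).symm)
      · by_contra hne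
        have hk : k' - k ≠ 0 := fun h0 => hne (by rw [sub_eq_zero.1 h0])
        refine hc _ _ (hdim _) (hdim _) (isCompl_ker_of_ker_sub_eq hV hW₀ (shift k π).2
          (shift k' π).2 ?_) h
        have hsub : (shift k' π).1 - (shift k π).1 = ψ (k' - k) := by simp [shift]
        rw [hsub, hψ _ hk]
    have hbij : Function.Bijective s := (Fintype.bijective_iff_injective_and_card s).2
      ⟨hinj, le_antisymm (Fintype.card_le_of_injective s hinj)
        (by rw [Fintype.card_option, hL]; exact hκ)⟩
    have h1 := hbij.sum_comp (fun x => if x = C then (1 : ℝ) else 0)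
    rw [Fintype.sum_option, sum_ite_eq' univ C, if_pos (mem_univ _)] at h1
    simp only [classIndicator]
    exact eq_sub_of_add_eq' h1
  -- Each shift permutes the projections, so every k contributes the full sum over the complements
  -- of W₀.
  have hsum : ∑ k : L, sumCompl t (classIndicator c C) W₀ =
      (Fintype.card F : ℝ) ^ (t * t) * (1 - classIndicator c C W₀) := by
    rw [sum_congr rfl (g := fun k => ∑ π : {π : V →ₗ[F] W₀ // ∀ x : W₀, π x = x},
      classIndicator c C (shift k π).1.ker)]
    · rw [sum_comm, sum_congr rfl fun π _ => hspread π, sum_const, nsmul_eq_mul, card_univ,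
        ← Nat.card_eq_fintype_card, natCard_proj hV hW₀]
      push_cast; rfl
    · intro k _
      rw [sumCompl_eq_sum_proj hV hW₀]
      exact ((shift k).sum_comp fun π => classIndicator c C π.1.ker).symm
  rw [sum_const, card_univ, hL, nsmul_eq_mul] at hsum
  have hq : (0 : ℝ) < (Fintype.card F : ℝ) ^ t := pow_pos (by exact_mod_cast Fintype.card_pos) _
  refine mul_left_cancel₀ hq.ne' ?_
  rw [← mul_assoc, ← pow_add]
  obtain ⟨s, rfl⟩ := Nat.exists_eq_add_of_le ht
  rw [show 1 + s + (1 + s - 1) * (1 + s) = (1 + s) * (1 + s) by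
    rw [Nat.add_sub_cancel_left]; ring]
  exact_mod_cast hsum

end Spread

/-! ### Rigidity of colour classes and the colouring bound -/

section Colouring

variable {F V : Type*} [Field F] [Fintype F] [AddCommGroup V] [Module F V] [Fintype V]
  [Fintype (Submodule F V)]

theorem card_pencil_mul {k n : ℕ} {S T : Submodule F V} (h : S ≤ T) (hS : finrank F S = k)
    (hT : finrank F T = k + n) :
    (#(pencil S T) : ℝ) * ((Fintype.card F : ℝ) - 1) = (Fintype.card F : ℝ) ^ n - 1 := by
  have h1 := card_pencil h
  rw [hS, hT, pow_add, pow_add, pow_one] at h1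
  have h2 : (0 : ℝ) < (Fintype.card F : ℝ) ^ k := pow_pos (by exact_mod_cast Fintype.card_pos) _
  refine mul_left_cancel₀ h2.ne' ?_
  linarith

theorem card_pencil_of_finrank_add_two {S T : Submodule F V} (h : S ≤ T)
    (hT : finrank F T = finrank F S + 2) : (#(pencil S T) : ℝ) = Fintype.card F + 1 := by
  have hq : (1 : ℝ) < Fintype.card F := by exact_mod_cast Fintype.one_lt_card
  have h1 := card_pencil_mul h rfl hT
  refine mul_right_cancel₀ (sub_pos.2 hq).ne' ?_
  rw [h1]; ring

theorem card_pencil_succ {S Y T : Submodule F V} (hSY : S ≤ Y) (hYT : Y ≤ T)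
    (hT : finrank F T = finrank F Y + 1) :
    (#(pencil S T) : ℝ) = Fintype.card F * #(pencil S Y) + 1 := by
  have hq : (1 : ℝ) < Fintype.card F := by exact_mod_cast Fintype.one_lt_card
  obtain ⟨n, hn⟩ := Nat.exists_eq_add_of_le (Submodule.finrank_mono hSY)
  have h1 := card_pencil_mul hSY rfl hn
  have h2 := card_pencil_mul (n := n + 1) (hSY.trans hYT) rfl (by omega)
  refine mul_right_cancel₀ (sub_pos.2 hq).ne' ?_
  rw [h2, add_mul, mul_assoc, h1]; ring

theorem two_le_card_pencil {S Y : Submodule F V} (hSY : S ≤ Y)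
    (hY : finrank F S + 2 ≤ finrank F Y) : (2 : ℝ) ≤ #(pencil S Y) := by
  have hq : (1 : ℝ) < Fintype.card F := by exact_mod_cast Fintype.one_lt_card
  obtain ⟨n, hn⟩ := Nat.exists_eq_add_of_le hY
  have h1 := card_pencil_mul (n := 2 + n) hSY rfl (by omega)
  have h2 : (Fintype.card F : ℝ) ^ 2 ≤ (Fintype.card F : ℝ) ^ (2 + n) :=
    pow_le_pow_right₀ hq.le (by omega)
  by_contra! h3
  nlinarith

/-- A set of `t`-dimensional subspaces, given by its indicator function `f`, that contains exactly
one member of each spread; `g` is a weight on the vectors whose masses are the values of `f`. -/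
structure IsTightFamily (t : ℕ) (f : Submodule F V → ℝ) (g : V → ℝ) : Prop where
  weight_zero : g 0 = 0
  weight_total : ∑ v, g v = 1
  eq_mass : ∀ W : Submodule F V, finrank F W = t → f W = subspaceMass g W
  zero_or_one : ∀ W, f W = 0 ∨ f W = 1
  compl : ∀ W : Submodule F V, finrank F W = t →
    sumCompl t f W = (Fintype.card F : ℝ) ^ ((t - 1) * t) * (1 - f W)

namespace IsTightFamily

variable {t : ℕ} {f : Submodule F V → ℝ} {g : V → ℝ}

theorem nonneg (hf : IsTightFamily t f g) (W : Submodule F V) : 0 ≤ f W := by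
  rcases hf.zero_or_one W with h | h <;> simp [h]

theorem sum_pencil (hf : IsTightFamily t f g) {S T : Submodule F V} (hST : S ≤ T)
    (hS : finrank F S + 1 = t) :
    ∑ W ∈ pencil S T, f W =
      ((#(pencil S T) : ℝ) - 1) * subspaceMass g S + subspaceMass g T := by
  rw [← sum_pencil_subspaceMass g hST]
  exact sum_congr rfl fun W hW => hf.eq_mass W ((mem_pencil.1 hW).2.2.trans hS)

/-- The number of members above S is affine in the mass of S: one member means mass 0, more than one
means positive mass. -/
theorem sum_star (hf : IsTightFamily t f g) {S : Submodule F V} (hS : finrank F S + 1 = t) :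
    ∑ W ∈ pencil S ⊤, f W = ((#(pencil S ⊤) : ℝ) - 1) * subspaceMass g S + 1 := by
  rw [hf.sum_pencil le_top hS, subspaceMass_top, hf.weight_total]

theorem sum_line (hf : IsTightFamily t f g) {S T : Submodule F V} (hST : S ≤ T)
    (hS : finrank F S + 1 = t) (hT : finrank F T = t + 1) :
    ∑ W ∈ pencil S T, f W = Fintype.card F * subspaceMass g S + subspaceMass g T := by
  rw [hf.sum_pencil hST hS, card_pencil_of_finrank_add_two hST (by omega), add_sub_cancel_right]

theorem exists_of_sum_pos (hf : IsTightFamily t f g) {S T : Submodule F V}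
    (h : 0 < ∑ W ∈ pencil S T, f W) : ∃ W ∈ pencil S T, f W = 1 := by
  by_contra! h0
  refine h.ne' (sum_eq_zero fun W hW => (hf.zero_or_one W).resolve_right (h0 W hW))

/-- The weight g may be negative on vectors, but in dimension t masses are values of f, and
nonnegativity passes upwards by averaging over hyperplanes. -/
theorem mass_nonneg (hf : IsTightFamily t f g) (ht : 2 ≤ t) {T : Submodule F V}
    (hT : finrank F T = t + 1) : 0 ≤ subspaceMass g T := by
  refine subspaceMass_nonneg_of_hyperplanes g hf.weight_zero T (by omega) fun H _ hH => ?_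
  rw [← hf.eq_mass H (by omega)]
  exact hf.nonneg H

theorem not_isCompl (hf : IsTightFamily t f g) {W U : Submodule F V} (hW : finrank F W = t)
    (hU : finrank F U = t) (h1 : f W = 1) (h2 : f U = 1) : ¬ IsCompl W U := by
  intro h
  have h3 := hf.compl W hW
  rw [h1, sub_self, mul_zero, sumCompl, sum_eq_zero_iff_of_nonneg fun X _ => hf.nonneg X] at h3
  rw [h3 U (by simp [hU, h])] at h2
  exact zero_ne_one h2

theorem exists_isCompl (hf : IsTightFamily t f g) {W : Submodule F V} (hW : finrank F W = t)
    (h : f W = 0) : ∃ U : Submodule F V, finrank F U = t ∧ IsCompl W U ∧ f U = 1 := by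
  by_contra! h0
  have h3 := hf.compl W hW
  rw [h, sub_zero, mul_one, sumCompl, sum_eq_zero] at h3
  · exact (pow_pos (by exact_mod_cast Fintype.card_pos : (0 : ℝ) < Fintype.card F) _).ne h3
  · intro U hU
    rw [mem_filter, mem_grassmannian] at hU
    exact (hf.zero_or_one U).resolve_right (h0 U hU.1 hU.2)

/-- If two members contain `S`, then either all the `t`-dimensional subspaces containing `S` are
members, or just those that lie in a certain hyperplane. -/
theorem star_eq_top_or_hyperplane (hf : IsTightFamily t f g) (ht : 2 ≤ t)
    (hV : finrank F V = 2 * t) {S : Submodule F V} (hS : finrank F S + 1 = t)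
    (h : 1 < ∑ W ∈ pencil S ⊤, f W) :
    (∀ W ∈ pencil S ⊤, f W = 1) ∨
      ∃ Y, S ≤ Y ∧ finrank F Y + 1 = 2 * t ∧ ∀ W ∈ pencil S ⊤, f W = 1 ↔ W ≤ Y := by
  have hpos : 0 < subspaceMass g S := by
    rw [hf.sum_star hS] at h
    have h2 := two_le_card_pencil (le_top : S ≤ ⊤) (by rw [finrank_top]; omega)
    by_contra! h3
    nlinarith
  have hline : ∀ T, S ≤ T → finrank F T = t + 1 → ∃ W ∈ pencil S T, f W = 1 := by
    intro T hST hT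
    refine hf.exists_of_sum_pos ?_
    rw [hf.sum_line hST hS hT]
    have h1 := hf.mass_nonneg ht hT
    have h2 : (0 : ℝ) < Fintype.card F := by exact_mod_cast Fintype.card_pos
    positivity
  rw [or_iff_not_imp_left]
  intro hall
  push Not at hall
  obtain ⟨W', hW', hfW'⟩ := hall
  obtain ⟨hSW', -, hdW'⟩ := mem_pencil.1 hW'
  -- A nonmember has a complementary member U. Every member above S must meet U, outside S, and so
  -- lies in the hyperplane S ⊔ U.
  obtain ⟨U, hU, hWU, hfU⟩ :=
    hf.exists_isCompl (hdW'.trans hS) ((hf.zero_or_one W').resolve_right hfW')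
  have hSU : Disjoint S U := hWU.disjoint.mono_left hSW'
  have hY : finrank F ↥(S ⊔ U) + 1 = 2 * t := by
    have := Submodule.finrank_sup_add_finrank_inf_eq S U
    rw [hSU.eq_bot, finrank_bot] at this
    omega
  have hmem : ∀ W ∈ pencil S ⊤, f W = 1 → W ≤ S ⊔ U := by
    intro W hW hfW
    obtain ⟨hSW, -, hdW⟩ := mem_pencil.1 hW
    have hnd : ¬ Disjoint W U := fun hd => by
      refine hf.not_isCompl (hdW.trans hS) hU hfW hfU ⟨hd, codisjoint_iff.2 ?_⟩
      refine Submodule.eq_top_of_finrank_eq ?_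
      have := Submodule.finrank_sup_add_finrank_inf_eq W U
      rw [hd.eq_bot, finrank_bot] at this
      omega
    rw [disjoint_iff, ← ne_eq, Submodule.ne_bot_iff] at hnd
    obtain ⟨v, hv, hv0⟩ := hnd
    have hvS : v ∉ S := fun h => hv0 (Submodule.disjoint_def.1 hSU v h hv.2)
    rw [eq_sup_span_singleton hSW hv.1 hvS hdW]
    exact sup_le_sup_left (by simpa using hv.2) _
  refine ⟨S ⊔ U, le_sup_left, hY, fun W hW => ⟨hmem W hW, fun hWY => ?_⟩⟩
  obtain ⟨hSW, -, hdW⟩ := mem_pencil.1 hW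
  -- Conversely, enlarge W by a vector v outside the hyperplane: the result contains a member above
  -- S, which lies in the hyperplane and hence equals W.
  obtain ⟨v, -, hv⟩ := SetLike.exists_of_lt (lt_top_iff_ne_top.2 fun h : S ⊔ U = ⊤ => by
    rw [h, finrank_top] at hY; omega)
  have hvW : v ∉ W := fun h => hv (hWY h)
  have hT := Submodule.finrank_sup_span_singleton hvW
  obtain ⟨W₁, hW₁, hfW₁⟩ := hline (W ⊔ F ∙ v) (hSW.trans le_sup_left) (by omega)
  obtain ⟨hSW₁, hW₁T, hdW₁⟩ := mem_pencil.1 hW₁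
  have hW₁Y := hmem W₁ (mem_pencil.2 ⟨hSW₁, le_top, hdW₁⟩) hfW₁
  have hvT : v ∈ W ⊔ F ∙ v := Submodule.mem_sup_right (Submodule.mem_span_singleton_self v)
  have hlt : (W ⊔ F ∙ v) ⊓ (S ⊔ U) < W ⊔ F ∙ v :=
    lt_of_le_of_ne inf_le_left fun h => hv ((inf_eq_left.1 h) hvT)
  have hWeq : W = (W ⊔ F ∙ v) ⊓ (S ⊔ U) := by
    refine Submodule.eq_of_le_of_finrank_le (le_inf le_sup_left hWY) ?_
    have := Submodule.finrank_lt_finrank_of_lt hlt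
    omega
  have : W₁ = W := by
    refine Submodule.eq_of_le_of_finrank_eq ?_ (hdW₁.trans hdW.symm)
    rw [hWeq]
    exact le_inf hW₁T hW₁Y
  rw [← this, hfW₁]

/-- A single member above S means that S has mass 0, and then the mass of T is the number of members
between S and T. -/
theorem mass_eq_of_unique (hf : IsTightFamily t f g) (ht : 2 ≤ t) (hV : finrank F V = 2 * t)
    {S W T : Submodule F V} (hS : finrank F S + 1 = t) (hW : W ∈ pencil S T) (hfW : f W = 1)
    (hT : finrank F T = t + 1) (h : ∑ W ∈ pencil S ⊤, f W ≤ 1) :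
    subspaceMass g T = 1 := by
  obtain ⟨hSW, hWT, hdW⟩ := mem_pencil.1 hW
  have hsub : pencil S T ⊆ pencil S ⊤ := fun X hX => by
    simp only [mem_pencil] at hX ⊢
    exact ⟨hX.1, le_top, hX.2.2⟩
  have h1 : 1 ≤ ∑ W ∈ pencil S T, f W := by
    rw [← hfW]
    exact single_le_sum (fun X _ => hf.nonneg X) hW
  have h2 : ∑ W ∈ pencil S T, f W ≤ ∑ W ∈ pencil S ⊤, f W :=
    sum_le_sum_of_subset_of_nonneg hsub fun X _ _ => hf.nonneg X
  have h3 := two_le_card_pencil (le_top : S ≤ ⊤) (by rw [finrank_top]; omega)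
  have h4 := hf.sum_star hS
  have h5 : ((#(pencil S ⊤) : ℝ) - 1) * subspaceMass g S = 0 := by linarith
  have h6 := (mul_eq_zero.1 h5).resolve_left (by linarith)
  have h7 := hf.sum_line (hSW.trans hWT) hS hT
  rw [h6] at h7
  linarith

theorem exists_hyperplane_above (ht : 2 ≤ t) (hV : finrank F V = 2 * t) {S : Submodule F V}
    (hS : finrank F S + 1 = t) :
    ∃ Y, S ≤ Y ∧ finrank F Y + 1 = 2 * t := by
  obtain ⟨Y, h1, -, h2⟩ := exists_between_finrank_eq (le_top : S ≤ ⊤) (k := 2 * t - 1)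
    (by omega) (by rw [finrank_top]; omega)
  exact ⟨Y, h1, by omega⟩

theorem card_star (hV : finrank F V = 2 * t) {S Y : Submodule F V}
    (hSY : S ≤ Y) (hY : finrank F Y + 1 = 2 * t) :
    (#(pencil S ⊤) : ℝ) = Fintype.card F * #(pencil S Y) + 1 :=
  card_pencil_succ hSY le_top (by rw [finrank_top]; omega)

/-- With no member between S and T, q times the mass of S would be -1. If n ≥ 2 counts the
t-dimensional subspaces between S and a hyperplane, the number of members above S would be 1 - n <
0. -/
theorem exists_mem_pencil (hf : IsTightFamily t f g) (ht : 2 ≤ t) (hV : finrank F V = 2 * t)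
    {S T : Submodule F V} (hST : S ≤ T) (hS : finrank F S + 1 = t) (hT : finrank F T = t + 1)
    (h : subspaceMass g T = 1) : ∃ W ∈ pencil S T, f W = 1 := by
  refine hf.exists_of_sum_pos ?_
  rw [hf.sum_line hST hS hT, h]
  obtain ⟨Y, hSY, hY⟩ := exists_hyperplane_above ht hV hS
  have h1 := hf.sum_star hS
  rw [card_star hV hSY hY, add_sub_cancel_right] at h1
  have h2 : 0 ≤ ∑ W ∈ pencil S ⊤, f W := sum_nonneg fun X _ => hf.nonneg X
  have h3 := two_le_card_pencil hSY (by omega)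
  by_contra! h4
  nlinarith

/-- The hyperplane case cannot occur: with n members above S and m of them inside T, eliminating the
mass of S gives n(m - 1) = n - 1, which no integer m satisfies when n ≥ 2. So exactly one member
lies above S. -/
theorem mass_eq_zero (hf : IsTightFamily t f g) (ht : 2 ≤ t) (hV : finrank F V = 2 * t)
    {S T : Submodule F V} (hST : S ≤ T) (hS : finrank F S + 1 = t) (hT : finrank F T = t + 1)
    (h : subspaceMass g T = 1) (hne : ∃ W ∈ pencil S ⊤, f W ≠ 1) : subspaceMass g S = 0 := by
  obtain ⟨W, hW, hfW⟩ := hf.exists_mem_pencil ht hV hST hS hT h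
  obtain ⟨hSW, hWT, hdW⟩ := mem_pencil.1 hW
  have h1 := hf.sum_star hS
  rcases le_or_gt (∑ W ∈ pencil S ⊤, f W) 1 with hle | hgt
  · have h2 : 1 ≤ ∑ W ∈ pencil S ⊤, f W := by
      rw [← hfW]
      exact single_le_sum (fun X _ => hf.nonneg X) (mem_pencil.2 ⟨hSW, le_top, hdW⟩)
    have h3 := two_le_card_pencil (le_top : S ≤ ⊤) (by rw [finrank_top]; omega)
    have h5 : ((#(pencil S ⊤) : ℝ) - 1) * subspaceMass g S = 0 := by linarith
    exact (mul_eq_zero.1 h5).resolve_left (by linarith)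
  · exfalso
    rcases hf.star_eq_top_or_hyperplane ht hV hS hgt with hall | ⟨Y, hSY, hY, hiff⟩
    · obtain ⟨X, hX, hfX⟩ := hne
      exact hfX (hall X hX)
    · have h2 : ∑ W ∈ pencil S ⊤, f W = #(pencil S Y) := by
        rw [← sum_subset (s₁ := pencil S Y) (s₂ := pencil S ⊤)]
        · rw [sum_congr rfl (g := fun _ => (1 : ℝ)), sum_const, nsmul_eq_mul, mul_one]
          intro X hX
          obtain ⟨a, b, d⟩ := mem_pencil.1 hX
          exact (hiff X (mem_pencil.2 ⟨a, le_top, d⟩)).2 b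
        · intro X hX
          obtain ⟨a, b, d⟩ := mem_pencil.1 hX
          exact mem_pencil.2 ⟨a, le_top, d⟩
        · intro X hX hXY
          refine (hf.zero_or_one X).resolve_right fun hX1 => hXY ?_
          obtain ⟨a, -, d⟩ := mem_pencil.1 hX
          exact mem_pencil.2 ⟨a, (hiff X hX).1 hX1, d⟩
      have h3 : ∑ W ∈ pencil S T, f W = (#{W ∈ pencil S T | f W = 1} : ℝ) := by
        rw [card_filter, Nat.cast_sum]
        refine sum_congr rfl fun X _ => ?_
        rcases hf.zero_or_one X with h0 | h0 <;> simp [h0]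
      rw [hf.sum_line hST hS hT, h] at h3
      rw [h2, card_star hV hSY hY, add_sub_cancel_right] at h1
      have h4 := two_le_card_pencil hSY (by omega)
      generalize #{W ∈ pencil S T | f W = 1} = m at h3
      generalize #(pencil S Y) = n at h1 h4
      have h5 : (n : ℝ) * (m - 1) = n - 1 := by
        rw [← h3]; linarith
      rcases Nat.lt_or_ge m 2 with hm | hm
      · have : (m : ℝ) ≤ 1 := by exact_mod_cast Nat.lt_succ_iff.1 hm
        nlinarith
      · have : (2 : ℝ) ≤ m := by exact_mod_cast hm
        nlinarith

end IsTightFamily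

/-- The `t`-dimensional subspaces of a `2 * t`-dimensional space over `F`, where `t ≥ 2`, cannot be
coloured with `|F| ^ t + 1` colours such that complementary subspaces get distinct colours. -/
theorem card_lt_of_colouring {t : ℕ} (ht : 2 ≤ t) (hV : finrank F V = 2 * t)
    {κ : Type*} [Fintype κ] (c : Submodule F V → κ)
    (hc : ∀ W W' : Submodule F V, finrank F W = t → finrank F W' = t → IsCompl W W' → c W ≠ c W') :
    Fintype.card F ^ t + 1 < Fintype.card κ := by
  by_contra! hκ
  have htight : ∀ C, ∃ g : V → ℝ, IsTightFamily t (classIndicator c C) g := by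
    intro C
    have h1 := sumCompl_classIndicator (by omega) hV hκ c hc C
    obtain ⟨g, h2, h3, h4⟩ := eq_subspaceMass_of_sumCompl (by omega) hV (classIndicator c C)
      fun W hW => h1 W (mem_grassmannian.1 hW)
    refine ⟨g, h2, h3, fun W hW => h4 W (mem_grassmannian.2 hW), fun W => ?_, h1⟩
    rw [classIndicator]
    split_ifs <;> simp
  choose g hg using htight
  have hind : ∀ C W, classIndicator c C W = 1 ↔ c W = C := by
    intro C W
    rw [classIndicator]
    split_ifs with h <;> simp [h]
  obtain ⟨W₀, -, -, hW₀⟩ := exists_between_finrank_eq (F := F) (V := V) (bot_le : ⊥ ≤ ⊤) (k := t)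
    (by simp) (by rw [finrank_top]; omega)
  have hm₀ : subspaceMass (g (c W₀)) W₀ = 1 := by
    rw [← (hg (c W₀)).eq_mass W₀ hW₀, hind]
  -- If everything above S had the colour of W₀, then S would have mass 1; this choice of S excludes
  -- that.
  obtain ⟨S, hSW₀, hS, hSne⟩ := exists_hyperplane_subspaceMass_ne (g (c W₀))
    (hg (c W₀)).weight_zero W₀ (by omega) (by rw [hm₀]; exact one_ne_zero)
  rw [hW₀] at hS
  rw [hm₀] at hSne
  have hW₀S : W₀ ∈ pencil S ⊤ := mem_pencil.2 ⟨hSW₀, le_top, by omega⟩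
  obtain ⟨W', hW', hcW'⟩ : ∃ W' ∈ pencil S ⊤, c W' ≠ c W₀ := by
    by_contra! hall
    have h1 := (hg (c W₀)).sum_star hS
    rw [sum_congr rfl fun W hW => (hind (c W₀) W).2 (hall W hW), sum_const, nsmul_eq_mul,
      mul_one] at h1
    have h3 := two_le_card_pencil (le_top : S ≤ ⊤) (by rw [finrank_top]; omega)
    have h4 : ((#(pencil S ⊤) : ℝ) - 1) * (subspaceMass (g (c W₀)) S - 1) = 0 := by linarith
    rcases mul_eq_zero.1 h4 with h5 | h5
    · linarith
    · exact hSne (sub_eq_zero.1 h5)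
  have hsmall : ∃ W₁ ∈ pencil S ⊤, ∃ W₂ ∈ pencil S ⊤, c W₁ ≠ c W₂ ∧
      ∑ W ∈ pencil S ⊤, classIndicator c (c W₁) W ≤ 1 ∧
      ∑ W ∈ pencil S ⊤, classIndicator c (c W₂) W ≤ 1 := by
    have hdich : ∀ C, 1 < ∑ W ∈ pencil S ⊤, classIndicator c C W →
        ∃ Y, S ≤ Y ∧ finrank F Y + 1 = 2 * t ∧ ∀ W ∈ pencil S ⊤, c W = C ↔ W ≤ Y := by
      intro C hC
      rcases (hg C).star_eq_top_or_hyperplane ht hV hS hC with h | ⟨Y, h1, h2, h3⟩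
      · exact absurd (((hind C W').1 (h W' hW')).trans ((hind C W₀).1 (h W₀ hW₀S)).symm) hcW'
      · exact ⟨Y, h1, h2, fun W hW => by rw [← h3 W hW, hind]⟩
    by_cases hbig : ∃ C, 1 < ∑ W ∈ pencil S ⊤, classIndicator c C W
    · obtain ⟨C, hC⟩ := hbig
      obtain ⟨Y, hSY, hY, hCY⟩ := hdich C hC
      -- Two hyperplanes above S meet in dimension at least 2t - 2 > t - 1, so they share a
      -- t-dimensional subspace above S, which would have both colours.
      have hother : ∀ D, D ≠ C → ∑ W ∈ pencil S ⊤, classIndicator c D W ≤ 1 := by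
        intro D hDC
        by_contra! hD
        obtain ⟨Z, hSZ, hZ, hDZ⟩ := hdich D hD
        obtain ⟨v, hv, hvS⟩ : ∃ v ∈ Y ⊓ Z, v ∉ S := by
          by_contra! hle
          have h1 := Submodule.finrank_mono (show Y ⊓ Z ≤ S from hle)
          have h2 := Submodule.finrank_sup_add_finrank_inf_eq Y Z
          have h3 := (Y ⊔ Z).finrank_le
          omega
        have hW : S ⊔ F ∙ v ∈ pencil S ⊤ :=
          mem_pencil.2 ⟨le_sup_left, le_top, Submodule.finrank_sup_span_singleton hvS⟩
        have h1 := (hCY _ hW).2 (sup_le hSY (by simpa using hv.1))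
        have h2 := (hDZ _ hW).2 (sup_le hSZ (by simpa using hv.2))
        exact hDC (h2.symm.trans h1)
      -- The vectors v and v + y yield distinct subspaces above S outside Y. Neither has colour C,
      -- and a common colour would occur twice above S.
      obtain ⟨v, -, hv⟩ := SetLike.exists_of_lt (lt_top_iff_ne_top.2 fun h : Y = ⊤ => by
        rw [h, finrank_top] at hY; omega)
      obtain ⟨y, hyY, hyS⟩ := SetLike.exists_of_lt (lt_of_le_of_ne hSY fun h => by
        rw [← h] at hY; omega)
      have hvy : v + y ∉ Y := fun h => hv (by simpa using Y.sub_mem h hyY)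
      have hmem : ∀ x, x ∉ Y → S ⊔ F ∙ x ∈ pencil S ⊤ ∧ c (S ⊔ F ∙ x) ≠ C := by
        intro x hx
        have hxS : x ∉ S := fun h => hx (hSY h)
        have h1 : S ⊔ F ∙ x ∈ pencil S ⊤ :=
          mem_pencil.2 ⟨le_sup_left, le_top, Submodule.finrank_sup_span_singleton hxS⟩
        refine ⟨h1, fun h2 => hx ((hCY _ h1).1 h2 ?_)⟩
        exact Submodule.mem_sup_right (Submodule.mem_span_singleton_self x)
      obtain ⟨h1, hc1⟩ := hmem v hv
      obtain ⟨h2, hc2⟩ := hmem (v + y) hvy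
      refine ⟨_, h1, _, h2, fun heq => ?_, hother _ hc1, hother _ hc2⟩
      have hneq : S ⊔ F ∙ v ≠ S ⊔ F ∙ (v + y) := by
        intro h
        have h3 : v ∈ S ⊔ F ∙ v := Submodule.mem_sup_right (Submodule.mem_span_singleton_self v)
        have h4 : v + y ∈ S ⊔ F ∙ v := by
          rw [h]; exact Submodule.mem_sup_right (Submodule.mem_span_singleton_self _)
        have h5 : y ∈ S ⊔ F ∙ v := by simpa using Submodule.sub_mem _ h4 h3
        have h6 := eq_sup_span_singleton le_sup_left h5 hyS (mem_pencil.1 h1).2.2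
        rw [h6] at h3
        exact hv ((sup_le hSY (by simpa using hyY) : S ⊔ F ∙ y ≤ Y) h3)
      have h3 : ∑ W ∈ {S ⊔ F ∙ v, S ⊔ F ∙ (v + y)}, classIndicator c (c (S ⊔ F ∙ v)) W ≤
          ∑ W ∈ pencil S ⊤, classIndicator c (c (S ⊔ F ∙ v)) W :=
        sum_le_sum_of_subset_of_nonneg
          (insert_subset_iff.2 ⟨h1, singleton_subset_iff.2 h2⟩) fun X _ _ => (hg _).nonneg X
      rw [sum_pair hneq, (hind _ _).2 rfl, (hind _ _).2 heq.symm] at h3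
      have := hother _ hc1
      linarith
    · push Not at hbig
      exact ⟨W', hW', W₀, hW₀S, hcW', hbig _, hbig _⟩
  obtain ⟨W₁, hW₁, W₂, hW₂, hne, hs₁, hs₂⟩ := hsmall
  obtain ⟨hSW₁, -, hd₁⟩ := mem_pencil.1 hW₁
  obtain ⟨hSW₂, -, hd₂⟩ := mem_pencil.1 hW₂
  have hT : finrank F ↥(W₁ ⊔ W₂) = t + 1 := by
    have h1 := Submodule.finrank_sup_add_finrank_inf_eq W₁ W₂
    have h2 := Submodule.finrank_mono (le_inf hSW₁ hSW₂)
    have h3 : W₁ ⊓ W₂ < W₁ := lt_of_le_of_ne inf_le_left fun h => hne (by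
      rw [Submodule.eq_of_le_of_finrank_eq (inf_eq_left.1 h) (hd₁.trans hd₂.symm)])
    have h4 := Submodule.finrank_lt_finrank_of_lt h3
    omega
  have hT₁ := (hg (c W₁)).mass_eq_of_unique ht hV hS (mem_pencil.2 ⟨hSW₁, le_sup_left, hd₁⟩)
    ((hind _ _).2 rfl) hT hs₁
  have hT₂ := (hg (c W₂)).mass_eq_of_unique ht hV hS (mem_pencil.2 ⟨hSW₂, le_sup_right, hd₂⟩)
    ((hind _ _).2 rfl) hT hs₂
  -- Above each hyperplane H of W₁ there is also a subspace of the second colour, so `mass_eq_zero`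
  -- applies to H.
  have hzero : subspaceMass (g (c W₁)) W₁ = 0 := by
    refine subspaceMass_eq_zero_of_hyperplanes _ (hg _).weight_zero W₁ (by omega) fun H hH hdH => ?_
    have hHT : H ≤ W₁ ⊔ W₂ := hH.trans le_sup_left
    refine (hg (c W₁)).mass_eq_zero ht hV hHT (by omega) hT hT₁ ?_
    obtain ⟨X, hX, hfX⟩ := (hg (c W₂)).exists_mem_pencil ht hV hHT (by omega) hT hT₂
    obtain ⟨h1, -, h2⟩ := mem_pencil.1 hX
    refine ⟨X, mem_pencil.2 ⟨h1, le_top, h2⟩, fun h3 => hne ?_⟩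
    exact ((hind _ _).1 h3).symm.trans ((hind _ _).1 hfX)
  rw [← (hg (c W₁)).eq_mass W₁ (hd₁.trans hS), (hind _ _).2 rfl] at hzero
  exact one_ne_zero hzero

end Colouring

/-! ### Linear solutions of networks as conditions on kernels -/

section Networks

theorem Matrix.rank_eq_card_iff_mulVec {m n K : Type*} [Field K] [Fintype n]
    (M : Matrix m n K) : M.rank = Fintype.card n ↔ ∀ x, M.mulVec x = 0 → x = 0 := by
  have h1 := M.mulVecLin.finrank_range_add_finrank_ker
  rw [Module.finrank_fintype_fun_eq_card] at h1
  have h2 : M.rank = finrank K M.mulVecLin.range := rfl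
  rw [← h2] at h1
  have h3 : (∀ x, M.mulVec x = 0 → x = 0) ↔ finrank K M.mulVecLin.ker = 0 := by
    rw [Submodule.finrank_eq_zero, Submodule.eq_bot_iff]
    rfl
  rw [h3]
  omega

theorem MulticastNetwork.rank_nodeMatrix_iff (N : MulticastNetwork) {K : Type*} [Field K] {s : ℕ}
    (G : N.E → Matrix (Fin s) (Fin (N.h * s)) K) (τ : N.V) :
    (N.nodeMatrix G τ).rank = N.h * s ↔
      ∀ x, (∀ e, N.head e = τ → (G e).mulVec x = 0) → x = 0 := by
  have h := (N.nodeMatrix G τ).rank_eq_card_iff_mulVec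
  rw [Fintype.card_fin] at h
  rw [h]
  refine forall_congr' fun x => ?_
  have : (N.nodeMatrix G τ).mulVec x = 0 ↔ ∀ e, N.head e = τ → (G e).mulVec x = 0 :=
    ⟨fun h0 e he => funext fun i => congrFun h0 (⟨e, he⟩, i),
      fun h0 => funext fun i => congrFun (h0 i.1.1 i.1.2) i.2⟩
  rw [this]

theorem MulticastNetwork.LinearSolution.mulVec_eq_zero {N : MulticastNetwork} {K : Type*} [Field K]
    {s : ℕ} (L : N.LinearSolution K s) {e : N.E} (he : N.tail e ≠ N.source) {x : Fin (N.h * s) → K}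
    (hx : ∀ e', N.head e' = N.tail e → (L.globalMatrix e').mulVec x = 0) :
    (L.globalMatrix e).mulVec x = 0 := by
  rw [L.flow e he, Matrix.sum_mulVec]
  refine sum_eq_zero fun e' _ => ?_
  rw [← Matrix.mulVec_mulVec, hx _ e'.2, Matrix.mulVec_zero]

variable {F : Type*} [Field F] [Finite F] {t h : ℕ} {K : Type*} [Field K] {s : ℕ}

/-- The matrices on the edges into the middle layer of a Kneser network determine a solution, in
which the middle nodes forward what they receive. -/
theorem nonempty_kneser_linearSolution
    (A : KneserMiddle F t h → Matrix (Fin s) (Fin (h * s)) K)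
    (hA : ∀ S : KneserTerminal F t h, ∀ x, (∀ W ∈ S.1, (A W).mulVec x = 0) → x = 0) :
    Nonempty ((kneserNetwork F t h).LinearSolution K s) := by
  let G : KneserEdge F t h → Matrix (Fin s) (Fin (h * s)) K := Sum.elim A fun p => A p.2.1
  refine ⟨⟨G, fun _ _ => 1, ?_, ?_⟩⟩
  · rintro (W | p) he
    · exact absurd rfl he
    · have hsub :
          Subsingleton ((kneserNetwork F t h).In ((kneserNetwork F t h).tail (Sum.inr p))) := by
        constructor
        rintro ⟨W | p, hW⟩ ⟨W' | p', hW'⟩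
        · exact Subtype.ext (congrArg Sum.inl (Sum.inl.inj (Sum.inr.inj (hW.trans hW'.symm))))
        · cases Sum.inr.inj hW'
        · cases Sum.inr.inj hW
        · cases Sum.inr.inj hW
      let e₀ : (kneserNetwork F t h).In ((kneserNetwork F t h).tail (Sum.inr p)) :=
        ⟨Sum.inl p.2.1, rfl⟩
      exact ((Fintype.sum_subsingleton _ e₀).trans (Matrix.one_mul _)).symm
  · rintro _ ⟨S, rfl⟩
    exact (MulticastNetwork.rank_nodeMatrix_iff (kneserNetwork F t h) G _).2 fun x hx =>
      hA S x fun W hW => hx (Sum.inr ⟨S, ⟨W, hW⟩⟩) rfl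

theorem kneser_decode (L : (kneserNetwork F t h).LinearSolution K s) (S : KneserTerminal F t h)
    (x : Fin (h * s) → K) (hx : ∀ W ∈ S.1, (L.globalMatrix (Sum.inl W)).mulVec x = 0) : x = 0 := by
  refine (MulticastNetwork.rank_nodeMatrix_iff _ _ _).1 (L.decode (Sum.inr (Sum.inr S)) ⟨S, rfl⟩)
    x fun e he => ?_
  rcases e with W | ⟨S', W⟩
  · cases Sum.inr.inj he
  · obtain rfl : S' = S := Sum.inr.inj (Sum.inr.inj he)
    refine L.mulVec_eq_zero (e := Sum.inr ⟨S', W⟩) (fun h0 => by cases h0) ?_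
    rintro (W' | p) he'
    · obtain rfl : W' = W.1 := Sum.inl.inj (Sum.inr.inj he')
      exact hx _ W.2
    · cases Sum.inr.inj he'

/-- The ratio of the entries of a vector of length two. -/
noncomputable def ratio (v : Fin 2 → K) : Option K := if v 0 = 0 then none else some (v 1 / v 0)

/-- The value `none` is the point at infinity and is also taken at the zero vector. This is
harmless, since (1, 0) is annihilated by every vector with first entry 0. -/
theorem exists_common_annihilator {v w : Fin 2 → K} (hvw : ratio v = ratio w) :
    ∃ x : Fin 2 → K, x ≠ 0 ∧ v ⬝ᵥ x = 0 ∧ w ⬝ᵥ x = 0 := by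
  by_cases hv : v 0 = 0 <;> by_cases hw : w 0 = 0
  · exact ⟨![1, 0], fun h0 => one_ne_zero (congrFun h0 0), by simp [dotProduct, hv], by simp [dotProduct, hw]⟩
  · simp [ratio, hv, hw] at hvw
  · simp [ratio, hv, hw] at hvw
  · simp only [ratio, if_neg hv, if_neg hw, Option.some.injEq] at hvw
    refine ⟨![v 1 / v 0, -1], fun h0 => ?_, ?_, ?_⟩
    · have := congrFun h0 1
      simp at this
    · simp [dotProduct, Fin.sum_univ_two]
      field_simp
      ring
    · rw [hvw]
      simp [dotProduct, Fin.sum_univ_two]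
      field_simp
      ring

end Networks

/-! ### Scalar and vector solutions of the Kneser network -/

section Kneser

variable {F : Type*} [Field F] [Fintype F] {t : ℕ}

/-- The terminal given by a pair of complementary subspaces. -/
theorem exists_kneserTerminal_of_isCompl (ht : 2 ≤ t) {W W' : KneserMiddle F t 2}
    (h : IsCompl W.1 W'.1) : ∃ S : KneserTerminal F t 2, S.1 = {W, W'} := by
  refine ⟨⟨{W, W'}, card_pair ?_, ?_⟩, rfl⟩
  · rintro rfl
    have h1 := h.disjoint
    rw [disjoint_self] at h1
    have h2 := W.2
    rw [h1, finrank_bot] at h2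
    omega
  · rw [eq_top_iff, ← h.sup_eq_top]
    exact sup_le (le_iSup₂_of_le W (by simp) le_rfl) (le_iSup₂_of_le W' (by simp) le_rfl)

/-- Colour a subspace by the ratio of the row its middle node receives. Complementary subspaces of
one colour would leave their terminal blind to a nonzero message. The point at infinity accounts for
the + 1 in the colouring bound. -/
theorem lt_of_hasLinearSolution_one (ht : 2 ≤ t) {q' : ℕ}
    (hq' : (kneserNetwork F t 2).HasLinearSolution q' 1) : Fintype.card F ^ t < q' := by
  obtain ⟨K, _, _, rfl, ⟨L⟩⟩ := hq'
  let _ := Fintype.ofFinite (Submodule F (Fin (2 * t) → F))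
  let G : KneserMiddle F t 2 → Fin 2 → K := fun W => L.globalMatrix (Sum.inl W) 0
  let c : Submodule F (Fin (2 * t) → F) → Option K := fun W =>
    -- The colour outside dimension t is irrelevant.
    if hW : finrank F W = t then ratio (G ⟨W, hW⟩) else none
  have hlt := card_lt_of_colouring ht (by simp) c fun W W' hW hW' hWW' heq => by
    simp only [c, dif_pos hW, dif_pos hW'] at heq
    obtain ⟨x, hx, h1, h2⟩ := exists_common_annihilator heq
    obtain ⟨S, hS⟩ := exists_kneserTerminal_of_isCompl ht (W := ⟨W, hW⟩) (W' := ⟨W', hW'⟩) hWW'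
    refine hx (kneser_decode L S x fun X hX => ?_)
    rw [hS, mem_insert, mem_singleton] at hX
    funext i
    rw [Subsingleton.elim i 0]
    rcases hX with rfl | rfl
    · exact h1
    · exact h2
  rw [Fintype.card_option] at hlt
  omega

theorem exists_two_mem_kneserTerminal (S : KneserTerminal F t 2) :
    ∃ W ∈ S.1, ∃ W' ∈ S.1, W ≠ W' := by
  obtain ⟨W, W', hne, hS⟩ := card_eq_two.1 S.2.1
  exact ⟨W, by simp [hS], W', by simp [hS], hne⟩

/-- Guarantees that the infimum `qs` is attained, as `sInf ∅ = 0`. Rows (1, a) with distinct a are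
pairwise independent. -/
theorem exists_hasLinearSolution_one :
    ∃ q', (kneserNetwork F t 2).HasLinearSolution q' 1 := by
  let _ := Fintype.ofFinite (KneserMiddle F t 2)
  obtain ⟨p, hp, hprime⟩ := Nat.exists_infinite_primes (Fintype.card (KneserMiddle F t 2))
  have : Fact p.Prime := ⟨hprime⟩
  obtain ⟨a⟩ : Nonempty (KneserMiddle F t 2 ↪ ZMod p) :=
    Function.Embedding.nonempty_of_card_le (by rw [ZMod.card]; exact hp)
  refine ⟨p, ZMod p, inferInstance, inferInstance, ZMod.card p,
    nonempty_kneser_linearSolution (fun W => !![1, a W]) fun S x hx => ?_⟩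
  obtain ⟨W, hW, W', hW', hne⟩ := exists_two_mem_kneserTerminal S
  have h1 := congrFun (hx W hW) 0
  have h2 := congrFun (hx W' hW') 0
  simp [Matrix.mulVec, dotProduct, Fin.sum_univ_two] at h1 h2
  have h3 : (a W - a W') * x 1 = 0 := by linear_combination h1 - h2
  have h4 : x 1 = 0 := (mul_eq_zero.1 h3).resolve_left (sub_ne_zero.2 (a.injective.ne hne))
  have h5 : x 0 = 0 := by rw [h4] at h1; simpa using h1
  funext i
  fin_cases i
  · exact h5
  · exact h4

theorem hasLinearSolution_card :
    (kneserNetwork F t 2).HasLinearSolution (Fintype.card F) t := by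
  -- `HasLinearSolution` asks for a field in `Type`, so F is replaced by a copy there.
  have hsmall : Small.{0} F := Countable.toSmall F
  let e : F ≃+* Shrink.{0} F := (Shrink.ringEquiv F).symm
  let _ : Fintype (Shrink.{0} F) := Fintype.ofEquiv F e.toEquiv
  refine ⟨Shrink.{0} F, inferInstance, inferInstance, (Fintype.card_congr e.toEquiv).symm, ?_⟩
  let b : ∀ W : KneserMiddle F t 2, Basis (Fin t) F W.1 := fun W =>
    finBasisOfFinrankEq F W.1 W.2
  refine nonempty_kneser_linearSolution
    (fun W => Matrix.of fun i j => e ((b W i : Fin (2 * t) → F) j)) fun S x hx => ?_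
  let y : Fin (2 * t) → F := fun j => e.symm (x j)
  -- The rows at W form a basis of W, so a message invisible at the terminal is orthogonal to both
  -- its subspaces, hence to their sum.
  have hW : ∀ W ∈ S.1, W.1 ≤ (dotProductBilin F F |>.flip y).ker := by
    intro W hWS
    have h1 := (b W).span_eq
    have h2 := congrArg (Submodule.map W.1.subtype) h1
    rw [Submodule.map_top, Submodule.range_subtype, Submodule.map_span, ← Set.range_comp] at h2
    rw [← h2, Submodule.span_le]
    rintro _ ⟨i, rfl⟩
    have h3 := congrFun (hx W hWS) i
    have h4 := congrArg e.symm h3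
    simpa [Matrix.mulVec, dotProduct, y] using h4
  have htop : ∀ v : Fin (2 * t) → F, v ⬝ᵥ y = 0 := by
    intro v
    have h1 : (⊤ : Submodule F (Fin (2 * t) → F)) ≤ (dotProductBilin F F |>.flip y).ker := by
      rw [← S.2.2]
      exact iSup₂_le hW
    simpa using h1 (Submodule.mem_top (x := v))
  funext j
  have h1 := htop (Pi.single j 1)
  rw [single_one_dotProduct] at h1
  simpa [y] using h1

theorem psi_spec (x : ℝ) : IsPrimePow (psi x) ∧ x ≤ psi x := by
  have hne : {q : ℕ | IsPrimePow q ∧ x ≤ (q : ℝ)}.Nonempty := by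
    obtain ⟨n, hn⟩ := exists_nat_ge x
    obtain ⟨p, hp, hprime⟩ := Nat.exists_infinite_primes n
    exact ⟨p, hprime.isPrimePow, hn.trans (by exact_mod_cast hp)⟩
  exact Nat.sInf_mem hne

theorem psi_le {x : ℝ} {q : ℕ} (hq : IsPrimePow q) (h : x ≤ q) : psi x ≤ q :=
  Nat.sInf_le ⟨hq, h⟩

end Kneser

theorem mainTheorem5 (q t : ℕ) (hq : IsPrimePow q) (ht : 2 ≤ t)
    (F : Type*) [Field F] [Fintype F] (hF : Fintype.card F = q) :
    (psi ((q : ℝ) ^ t + 1) : ℤ) - (q : ℤ) ^ t ≤ (kneserNetwork F t 2).gap ∧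
      1 ≤ (psi ((q : ℝ) ^ t + 1) : ℤ) - (q : ℤ) ^ t := by
  subst hF
  have hqs : (kneserNetwork F t 2).HasLinearSolution (kneserNetwork F t 2).qs 1 :=
    Nat.sInf_mem exists_hasLinearSolution_one
  have hqv : (kneserNetwork F t 2).qv ≤ Fintype.card F ^ t :=
    Nat.sInf_le ⟨_, t, by omega, hasLinearSolution_card, rfl⟩
  have hlt := lt_of_hasLinearSolution_one ht hqs
  have hprime : IsPrimePow (kneserNetwork F t 2).qs := by
    obtain ⟨K, _, _, hK, -⟩ := hqs
    rw [← hK]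
    exact Fintype.isPrimePow_card_of_field
  have hpsi : psi ((Fintype.card F : ℝ) ^ t + 1) ≤ (kneserNetwork F t 2).qs :=
    psi_le hprime (by exact_mod_cast hlt)
  constructor
  · rw [MulticastNetwork.gap]
    have h1 : ((kneserNetwork F t 2).qv : ℤ) ≤ (Fintype.card F : ℤ) ^ t := by exact_mod_cast hqv
    have h2 : (psi ((Fintype.card F : ℝ) ^ t + 1) : ℤ) ≤ (kneserNetwork F t 2).qs := by
      exact_mod_cast hpsi
    linarith
  · have h1 : Fintype.card F ^ t + 1 ≤ psi ((Fintype.card F : ℝ) ^ t + 1) := by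
      exact_mod_cast (psi_spec ((Fintype.card F : ℝ) ^ t + 1)).2
    have h2 : (Fintype.card F : ℤ) ^ t + 1 ≤ psi ((Fintype.card F : ℝ) ^ t + 1) := by
      exact_mod_cast h1
    linarith
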